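/- A distribution function (df) is a non-decreasing right-continuous $F:\mathbb R\to[0,1]$ with $F(-\infty)=0$, $F(+\infty)=1$. Write $r(F)=\sup\{x:F(x)<1\}\in(-\infty,\infty]$ and $F^-(y)=\inf\{x:F(x)\ge y\}$. For a df $F$ and a non-degenerate df $G$, we say that $F\in\mathcal D_l(G)$ with norming constants $a_n,b_n$ if $a_n>0$ (for all large $n$), $b_n\in\mathbb R$ and $F^n(a_nx+b_n)\to G(x)$ at every continuity point $x$ of $G$; $F\in\mathcal D_l(G)$ means that such constants exist. For $\alpha>0$ let $\Phi_\alpha(x)=e^{-x^{-\alpha}}$ for $x>0$ and $0$ for $x\le 0$; $\Psi_\alpha(x)=e^{-|x|^{\alpha}}$ for $x<0$ and $1$ for $x\ge0$; $\Lambda(x)=e^{-e^{-x}}$ for $x\in\mathbb R$. Two dfs $F,G$ are tail equivalent if $r(F)=r(G)$ and $(1-F(x))/(1-G(x))$ has a limit in $(0,\infty)$ as $x\uparrow r(F)$. A function $v$, positive on $(-\infty,r(F))$, is called an auxiliary function of $F$ if $\lim_{t\uparrow r(F)}\frac{1-F(t+v(t)x)}{1-F(t)}=e^{-x}$ for all $x\ge0$.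 Theorem. Let $F$ be an absolutely continuous df with pdf $f$, let $k\ge1$ be an integer, let $H_k=1-(1-F)^k$, and let $$R_k(x)=1-\left(\frac{-\ln F(x)}{1-\ln F(x)}\right)^k\ \text{ if }F(x)>0,\qquad R_k(x)=0\ \text{ if }F(x)=0 .$$ (a) $R_k$ is a df, absolutely continuous with pdf $r_k(x)=\dfrac{k f(x)(-\ln F(x))^{k-1}}{F(x)(1-\ln F(x))^{k+1}}$ where $F(x)>0$ (and $r_k(x)=0$ elsewhere); $r(R_k)=r(F)$; $\lim_{x\uparrow r(F)}\dfrac{1-R_k(x)}{(1-F(x))^k}=1$; and $R_k$ is tail equivalent to $H_k$. (b) If $F\in\mathcal D_l(\Phi_\alpha)$, $\alpha>0$, then $r(R_k)=r(F)=\infty$ and $R_k\in\mathcal D_l(\Phi_{k\alpha})$ with norming constants $a_n=F^-(1-(1/n)^{1/k})$, $b_n=0$. (c) If $F\in\mathcal D_l(\Psi_\alpha)$, $\alpha>0$, then $r(R_k)=r(F)<\infty$ and $R_k\in\mathcal D_l(\Psi_{k\alpha})$ with norming constants $a_n=r(F)-F^-(1-(1/n)^{1/k})$, $b_n=r(F)$.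 (d) If $F\in\mathcal D_l(\Lambda)$, then $r(R_k)=r(F)$, $R_k\in\mathcal D_l(\Lambda)$, the mean residual life $v(t)=\int_t^{r(F)}(1-F(s))\,ds\,/\,(1-F(t))$ is an auxiliary function of $F$, and for every auxiliary function $v$ of $F$ one may take the norming constants $b_n=R_k^-(1-1/n)$, $a_n=v(b_n)/k$ for $R_k\in\mathcal D_l(\Lambda)$. -/

import Mathlib

open MeasureTheory Filter Topology

noncomputable section

/-- `F` is a (probability) distribution function on the real line. -/
structure IsDF (F : ℝ → ℝ) : Prop where
  mono : Monotone F
  right_cont : ∀ x, ContinuousWithinAt F (Set.Ici x) x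
  tendsto_atBot : Tendsto F atBot (𝓝 0)
  tendsto_atTop : Tendsto F atTop (𝓝 1)

/-- `f` is a probability density function of `F`; the distribution function `F` is absolutely
continuous exactly when it has such an `f`. -/
structure IsPDF (F f : ℝ → ℝ) : Prop where
  nonneg : ∀ x, 0 ≤ f x
  integrable : Integrable f
  eq_integral : ∀ x, F x = ∫ t in Set.Iic x, f t

/-- The right extremity `r(F) = sup {x : F x < 1}`, an extended real number. -/
def rightEnd (F : ℝ → ℝ) : EReal := sSup ((fun x : ℝ => (x : EReal)) '' {x : ℝ | F x < 1})

/-- The filter of real `x` increasing strictly to `r(F)`. -/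
def toRightEnd (F : ℝ → ℝ) : Filter ℝ :=
  comap (fun x : ℝ => (x : EReal)) (𝓝[<] (rightEnd F))

/-- The quantile function `F⁻(y) = inf {x : F x ≥ y}`, used for `0 < y < 1`. -/
def quantile (F : ℝ → ℝ) (y : ℝ) : ℝ := sInf {x : ℝ | y ≤ F x}

/-- The Fréchet law. -/
def frechet (α x : ℝ) : ℝ := if 0 < x then Real.exp (-x ^ (-α)) else 0

/-- The (extreme value) Weibull law. -/
def weibull (α x : ℝ) : ℝ := if x < 0 then Real.exp (-|x| ^ α) else 1

/-- The Gumbel law. -/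
def gumbel (x : ℝ) : ℝ := Real.exp (-Real.exp (-x))

/-- `a n > 0` and `b n` are norming constants with `F (a n * x + b n) ^ n → G x` at every continuity
point of `G`. Only large `n` matter, and explicit constants such as `F⁻(1 - 1/n)` need not be
positive (or meaningful) for the first few `n`. -/
def MaxConverges (F : ℝ → ℝ) (a b : ℕ → ℝ) (G : ℝ → ℝ) : Prop :=
  (∀ᶠ n in atTop, 0 < a n) ∧
    ∀ x, ContinuousAt G x → Tendsto (fun n : ℕ => F (a n * x + b n) ^ n) atTop (𝓝 (G x))

/-- `F` is in the max domain of attraction of (the non-degenerate distribution function) `G` under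
linear normalization. -/
def InMaxDomain (F G : ℝ → ℝ) : Prop := ∃ a b : ℕ → ℝ, MaxConverges F a b G

/-- `F` and `G` are tail equivalent: they have the same right extremity, and the ratio of their
tails there has a limit in `(0, ∞)`. -/
def TailEquivalent (F G : ℝ → ℝ) : Prop :=
  rightEnd F = rightEnd G ∧
    ∃ c : ℝ, 0 < c ∧ Tendsto (fun x => (1 - F x) / (1 - G x)) (toRightEnd F) (𝓝 c)

/-- `v` is an auxiliary function of `F` for the Gumbel domain of attraction. -/
def IsAuxiliary (F v : ℝ → ℝ) : Prop :=
  (∀ t : ℝ, (t : EReal) < rightEnd F → 0 < v t) ∧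
    ∀ x : ℝ, 0 ≤ x →
      Tendsto (fun t => (1 - F (t + v t * x)) / (1 - F t)) (toRightEnd F) (𝓝 (Real.exp (-x)))

/-- The mean residual life `∫_t^{r(F)} (1 - F s) ds / (1 - F t)`; the integrand vanishes
beyond `r(F)`. -/
def meanResidualLife (F : ℝ → ℝ) (t : ℝ) : ℝ := (∫ s in Set.Ioi t, (1 - F s)) / (1 - F t)

/-- `H_k = 1 - (1 - F)^k`. -/
def dfH (F : ℝ → ℝ) (k : ℕ) (x : ℝ) : ℝ := 1 - (1 - F x) ^ k

open Classical in
/-- `R_k = 1 - (-log F / (1 - log F))^k` where `F > 0`, and `0` elsewhere. -/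
def dfR (F : ℝ → ℝ) (k : ℕ) (x : ℝ) : ℝ :=
  if 0 < F x then 1 - (-Real.log (F x) / (1 - Real.log (F x))) ^ k else 0

open Classical in
/-- `r_k = k f (-log F)^(k-1) / (F (1 - log F)^(k+1))` where `F > 0`, and `0` elsewhere. -/
def pdfR (F f : ℝ → ℝ) (k : ℕ) (x : ℝ) : ℝ :=
  if 0 < F x then
    k * f x * (-Real.log (F x)) ^ (k - 1) / (F x * (1 - Real.log (F x)) ^ (k + 1))
  else 0

end

noncomputable section

/-! ### Distribution functions, their right extremity and quantiles -/

/-! `R_k` is a fixed function `transR k` of `F`, built from `logOdds u = -log u / (1 - log u)`.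
Since `logOdds u ∼ 1 - u` as `u → 1`, the tail of `R_k` is asymptotic to `(1 - F)^k`. The density
comes from the probability integral transform: `F` carries the measure `f dx` to the uniform law on
`(0, 1]`, so integrating `r_k` reduces to integrating the derivative of `transR k`.

For the domains of attraction, write the limit law as `exp (-τ)`. Convergence of powers becomes `n
(1 - F (a n x + b n)) → τ x`, packaged in `TailConverges`. Along `N = ⌊n^(1/k)⌋` the constants `a
N`, `b N` give `n (1 - R_k) → τ^k` (`tendsto_dfR_pow`), and `exp (-τ^k)` is again of the same
family. What remains is to identify explicit constants: `tendsto_normed` and `tendsto_tail`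
translate between the tail at a point and its normalized position, and `tendsto_types` compares `a`,
`b` at different indices. In the Fréchet case halving the index gives `b n / a n → 0`; in the
Weibull case doubling it gives `(r(F) - b n) / a n → 0`. In the Gumbel case `a` at index `⌊1 / (1 -
F t)⌋` is the natural scale at `t`, and the mean residual life is shown to be asymptotic to it. -/

theorem IsPDF.continuous {F f : ℝ → ℝ} (hf : IsPDF F f) : Continuous F := by
  have h : F = fun x => F 0 + ∫ t in (0 : ℝ)..x, f t := by
    funext x
    rw [← intervalIntegral.integral_Iic_sub_Iic hf.integrable.integrableOn
      hf.integrable.integrableOn, ← hf.eq_integral, ← hf.eq_integral]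
    ring
  rw [h]
  exact continuous_const.add
    (intervalIntegral.continuous_primitive (fun _ _ => hf.integrable.intervalIntegrable) 0)

namespace IsDF

variable {F : ℝ → ℝ}

theorem nonneg (hF : IsDF F) (x : ℝ) : 0 ≤ F x :=
  hF.mono.le_of_tendsto hF.tendsto_atBot x

theorem le_one (hF : IsDF F) (x : ℝ) : F x ≤ 1 :=
  hF.mono.ge_of_tendsto hF.tendsto_atTop x

theorem exists_eq (hF : IsDF F) (hc : Continuous F) {y : ℝ} (h0 : 0 < y) (h1 : y < 1) :
    ∃ x, F x = y := by
  obtain ⟨a, ha⟩ := (hF.tendsto_atBot.eventually (gt_mem_nhds h0)).exists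
  obtain ⟨b, hb⟩ := (hF.tendsto_atTop.eventually (lt_mem_nhds h1)).exists
  exact mem_range_of_exists_le_of_exists_ge hc ⟨a, ha.le⟩ ⟨b, hb.le⟩

theorem apply_quantile (hF : IsDF F) (hc : Continuous F) {y : ℝ} (h0 : 0 < y) (h1 : y < 1) :
    F (quantile F y) = y := by
  obtain ⟨x, hx⟩ := hF.exists_eq hc h0 h1
  have hbdd : BddBelow {x : ℝ | y ≤ F x} := by
    obtain ⟨a, ha⟩ := (hF.tendsto_atBot.eventually (gt_mem_nhds h0)).exists
    refine ⟨a, fun z hz => ?_⟩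
    by_contra! h
    exact absurd (hF.mono h.le) (not_le.2 (ha.trans_le hz))
  have hmem : quantile F y ∈ {x : ℝ | y ≤ F x} :=
    (isClosed_le continuous_const hc).csInf_mem ⟨x, hx.ge⟩ hbdd
  exact le_antisymm ((hF.mono (csInf_le hbdd hx.ge)).trans_eq hx) hmem

/-- Right continuity gives strictness: `F t < 1` persists slightly to the right of `t`. -/
theorem coe_lt_rightEnd (hF : IsDF F) {t : ℝ} : (t : EReal) < rightEnd F ↔ F t < 1 := by
  constructor
  · intro h
    obtain ⟨_, ⟨x, hx, rfl⟩, htx⟩ := lt_sSup_iff.1 h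
    exact (hF.mono (EReal.coe_lt_coe_iff.1 htx).le).trans_lt hx
  · intro h
    have h1 : ∀ᶠ s in 𝓝[>] t, F s < 1 :=
      ((hF.right_cont t).mono Set.Ioi_subset_Ici_self).eventually (gt_mem_nhds h)
    obtain ⟨s, hs, hts⟩ := (h1.and self_mem_nhdsWithin).exists
    exact (EReal.coe_lt_coe_iff.2 hts).trans_le (le_sSup ⟨s, hs, rfl⟩)

theorem bot_lt_rightEnd (hF : IsDF F) : ⊥ < rightEnd F := by
  obtain ⟨a, ha⟩ := (hF.tendsto_atBot.eventually (gt_mem_nhds (zero_lt_one' ℝ))).exists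
  exact (EReal.bot_lt_coe a).trans (hF.coe_lt_rightEnd.2 ha)

theorem rightEnd_eq_of_iff {G : ℝ → ℝ} (h : ∀ x, F x < 1 ↔ G x < 1) :
    rightEnd F = rightEnd G := by
  simp only [rightEnd, h]

/-- Expressing the filter through `F` alone treats finite and infinite right extremities together.
-/
theorem hasBasis_toRightEnd (hF : IsDF F) :
    (toRightEnd F).HasBasis (fun t₀ : ℝ => F t₀ < 1) (fun t₀ => {t | t₀ < t ∧ F t < 1}) := by
  have h := (nhdsLT_basis_of_exists_lt ⟨⊥, hF.bot_lt_rightEnd⟩).comap (fun x : ℝ => (x : EReal))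
  refine h.to_hasBasis ?_ ?_
  · intro a ha
    obtain ⟨c, hac, hc⟩ := EReal.lt_iff_exists_real_btwn.1 ha
    refine ⟨c, hF.coe_lt_rightEnd.1 hc, fun t ht => ⟨?_, hF.coe_lt_rightEnd.2 ht.2⟩⟩
    exact hac.trans (EReal.coe_lt_coe_iff.2 ht.1)
  · intro t₀ ht₀
    refine ⟨t₀, hF.coe_lt_rightEnd.2 ht₀, fun t ht => ?_⟩
    exact ⟨EReal.coe_lt_coe_iff.1 ht.1, hF.coe_lt_rightEnd.1 ht.2⟩

theorem eventually_lt_one (hF : IsDF F) : ∀ᶠ t in toRightEnd F, F t < 1 := by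
  obtain ⟨a, ha⟩ := (hF.tendsto_atBot.eventually (gt_mem_nhds (zero_lt_one' ℝ))).exists
  exact hF.hasBasis_toRightEnd.eventually_iff.2 ⟨a, ha, fun t ht => ht.2⟩

theorem tendsto_one (hF : IsDF F) (hc : Continuous F) :
    Tendsto F (toRightEnd F) (𝓝[<] 1) := by
  refine tendsto_nhdsWithin_iff.2 ⟨?_, hF.eventually_lt_one⟩
  refine tendsto_order.2 ⟨fun y hy => ?_, fun y hy => ?_⟩
  -- The level must exceed `y` and lie in `(0, 1)`; the `1 / 2` covers negative `y`.
  · obtain ⟨x, hx⟩ := hF.exists_eq hc (y := max ((1 + y) / 2) (1 / 2)) (by positivity)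
      (max_lt (by linarith) (by norm_num))
    refine hF.hasBasis_toRightEnd.eventually_iff.2 ⟨x, ?_, fun t ht => ?_⟩
    · rw [hx]; exact max_lt (by linarith) (by norm_num)
    · have := hF.mono ht.1.le
      have h2 := le_max_left ((1 + y) / 2) (1 / 2 : ℝ)
      linarith
  · exact Eventually.of_forall fun x => (hF.le_one x).trans_lt hy

theorem tendsto_toRightEnd (hF : IsDF F) {ι : Type*} {l : Filter ι} {t : ι → ℝ}
    (h : Tendsto (fun i => F (t i)) l (𝓝[<] 1)) : Tendsto t l (toRightEnd F) := by
  rw [tendsto_nhdsWithin_iff] at h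
  refine hF.hasBasis_toRightEnd.tendsto_right_iff.2 fun t₀ ht₀ => ?_
  filter_upwards [h.2, h.1.eventually (lt_mem_nhds ht₀)] with i hi h2
  refine ⟨?_, hi⟩
  by_contra! h3
  exact absurd (hF.mono h3) (not_le.2 h2)

instance (F : ℝ → ℝ) : (toRightEnd F).IsCountablyGenerated := by
  unfold toRightEnd; infer_instance

end IsDF

/-! ### The transformation `u ↦ -log u / (1 - log u)` of the tail -/

/-- `-log u / (1 - log u)`. -/
def logOdds (u : ℝ) : ℝ := -Real.log u / (1 - Real.log u)

/-- With the logarithm occurring only once, monotonicity, the bound by 1 and the limit at 0 can be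
read off. -/
theorem logOdds_eq {u : ℝ} (h1 : u ≤ 1) (h0 : 0 ≤ u) : logOdds u = 1 - 1 / (1 - Real.log u) := by
  have := Real.log_nonpos h0 h1
  have : (1 - Real.log u) ≠ 0 := by linarith
  unfold logOdds; field_simp; ring

theorem logOdds_nonneg {u : ℝ} (h0 : 0 ≤ u) (h1 : u ≤ 1) : 0 ≤ logOdds u := by
  have := Real.log_nonpos h0 h1
  exact div_nonneg (by linarith) (by linarith)

theorem logOdds_lt_one {u : ℝ} (h0 : 0 ≤ u) (h1 : u ≤ 1) : logOdds u < 1 := by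
  have := Real.log_nonpos h0 h1
  rw [logOdds_eq h1 h0]
  have : 0 < 1 / (1 - Real.log u) := by apply one_div_pos.2; linarith
  linarith

theorem logOdds_pos {u : ℝ} (h0 : 0 < u) (h1 : u < 1) : 0 < logOdds u := by
  have := Real.log_neg h0 h1
  exact div_pos (by linarith) (by linarith)

theorem logOdds_one : logOdds 1 = 0 := by simp [logOdds]

theorem logOdds_anti {u w : ℝ} (h0 : 0 < u) (huw : u ≤ w) (h1 : w ≤ 1) :
    logOdds w ≤ logOdds u := by
  rw [logOdds_eq h1 (h0.le.trans huw), logOdds_eq (huw.trans h1) h0.le]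
  have h2 := Real.log_le_log h0 huw
  have h3 := Real.log_nonpos (h0.le.trans huw) h1
  have : 1 / (1 - Real.log u) ≤ 1 / (1 - Real.log w) :=
    one_div_le_one_div_of_le (by linarith) (by linarith)
  linarith

theorem hasDerivAt_logOdds {u : ℝ} (h0 : 0 < u) (h1 : u ≤ 1) :
    HasDerivAt logOdds (-1 / (u * (1 - Real.log u) ^ 2)) u := by
  have hl := Real.log_nonpos h0.le h1
  have hne : 1 - Real.log u ≠ 0 := by linarith
  have h := (Real.hasDerivAt_log h0.ne').neg.div ((Real.hasDerivAt_log h0.ne').const_sub 1) hne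
  have h2 : HasDerivAt logOdds _ u := h
  convert h2 using 1
  simp only [Pi.neg_apply]
  field_simp
  ring

/-- The ratio of `logOdds u` and `1 - u`, extended continuously to `u = 1`. -/
def logOddsRatio (u : ℝ) : ℝ := -dslope logOdds 1 u

theorem logOdds_eq_mul (u : ℝ) : logOdds u = (1 - u) * logOddsRatio u := by
  have h := sub_smul_dslope logOdds 1 u
  rw [logOdds_one, sub_zero, smul_eq_mul] at h
  rw [← h, logOddsRatio]; ring

/-- The derivative of `logOdds` at 1 is `-1`; all tail asymptotics of `R_k` rest on this. -/
theorem tendsto_logOddsRatio : Tendsto logOddsRatio (𝓝 1) (𝓝 1) := by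
  have hd := hasDerivAt_logOdds zero_lt_one le_rfl
  have h := (continuousAt_dslope_same.2 hd.differentiableAt).neg
  have h2 : (-dslope logOdds 1) 1 = 1 := by
    simp [dslope_same, hd.deriv]
  have h3 : Tendsto (-dslope logOdds 1) (𝓝 1) (𝓝 ((-dslope logOdds 1) 1)) := h
  rw [h2] at h3
  exact h3

theorem tendsto_logOdds_zero : Tendsto logOdds (𝓝[>] 0) (𝓝 1) := by
  have h1 : Tendsto (fun u => 1 - Real.log u) (𝓝[>] 0) atTop :=
    tendsto_atTop_add_const_left _ 1 (tendsto_neg_atBot_atTop.comp Real.tendsto_log_nhdsGT_zero)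
  have h2 : Tendsto (fun u => 1 - 1 / (1 - Real.log u)) (𝓝[>] 0) (𝓝 (1 - 0)) := by
    simpa only [one_div, Function.comp_def] using (tendsto_inv_atTop_zero.comp h1).const_sub 1
  rw [sub_zero] at h2
  refine h2.congr' ?_
  filter_upwards [Ioo_mem_nhdsGT (zero_lt_one' ℝ)] with u hu
  rw [logOdds_eq hu.2.le hu.1.le]

open Classical in
/-- The function `φ` with `R_k = φ ∘ F`. -/
def transR (k : ℕ) (u : ℝ) : ℝ := if 0 < u then 1 - logOdds u ^ k else 0

open Classical in
/-- The derivative of `transR k`. -/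
def transRDeriv (k : ℕ) (u : ℝ) : ℝ :=
  if 0 < u then k * (-Real.log u) ^ (k - 1) / (u * (1 - Real.log u) ^ (k + 1)) else 0

theorem dfR_eq (F : ℝ → ℝ) (k : ℕ) : dfR F k = fun x => transR k (F x) := rfl

theorem pdfR_eq (F f : ℝ → ℝ) (k : ℕ) : pdfR F f k = fun x => f x * transRDeriv k (F x) := by
  funext x
  unfold pdfR transRDeriv
  split_ifs
  · ring
  · simp

theorem transR_mono {k : ℕ} {u w : ℝ} (h0 : 0 ≤ u) (huw : u ≤ w) (h1 : w ≤ 1) :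
    transR k u ≤ transR k w := by
  unfold transR
  rcases h0.eq_or_lt with rfl | h0
  · rw [if_neg (lt_irrefl _)]
    split_ifs with hw
    · have := pow_le_one₀ (n := k) (logOdds_nonneg hw.le h1) (logOdds_lt_one hw.le h1).le
      linarith
    · exact le_rfl
  · rw [if_pos h0, if_pos (h0.trans_le huw)]
    have := pow_le_pow_left₀ (logOdds_nonneg (h0.le.trans huw) h1) (logOdds_anti h0 huw h1) k
    linarith

theorem transR_zero (k : ℕ) : transR k 0 = 0 := by simp [transR]

theorem transR_one {k : ℕ} (hk : 1 ≤ k) : transR k 1 = 1 := by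
  simp [transR, logOdds_one, zero_pow (Nat.one_le_iff_ne_zero.1 hk)]

theorem transR_lt_one_iff {k : ℕ} (hk : 1 ≤ k) {u : ℝ} (h1 : u ≤ 1) :
    transR k u < 1 ↔ u < 1 := by
  constructor
  · intro h
    refine h1.lt_of_ne fun h2 => ?_
    rw [h2, transR_one hk] at h
    exact lt_irrefl _ h
  · intro h
    unfold transR
    split_ifs with hu
    · have := pow_pos (logOdds_pos hu h) k
      linarith
    · exact one_pos

/-- The value assigned at 0 agrees with the limit there, because `logOdds u → 1` as `u ↓ 0`. -/
theorem continuousOn_transR (k : ℕ) : ContinuousOn (transR k) (Set.Icc 0 1) := by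
  intro u hu
  rcases hu.1.eq_or_lt with h | h
  · subst h
    rw [ContinuousWithinAt, transR_zero]
    have h1 : Tendsto (transR k) (𝓝[>] 0) (𝓝 0) := by
      have : Tendsto (fun u => 1 - logOdds u ^ k) (𝓝[>] 0) (𝓝 (1 - 1 ^ k)) :=
        (tendsto_logOdds_zero.pow k).const_sub 1
      rw [one_pow, sub_self] at this
      refine this.congr' ?_
      filter_upwards [self_mem_nhdsWithin] with u hu
      exact (if_pos hu).symm
    have h2 : Tendsto (transR k) (𝓝[≥] 0) (𝓝 0) := by
      rw [← Set.Ioi_insert, nhdsWithin_insert, tendsto_sup]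
      exact ⟨by simpa [transR_zero] using tendsto_pure_nhds (transR k) 0, h1⟩
    exact h2.mono_left (nhdsWithin_mono _ fun x hx => hx.1)
  · have h1 : ContinuousAt (fun u => 1 - logOdds u ^ k) u :=
      ((hasDerivAt_logOdds h hu.2).continuousAt.pow k).const_sub 1 
    refine (h1.congr ?_).continuousWithinAt
    filter_upwards [lt_mem_nhds h] with w hw
    exact (if_pos hw).symm

theorem hasDerivAt_transR {k : ℕ} (hk : 1 ≤ k) {u : ℝ} (h0 : 0 < u) (h1 : u < 1) :
    HasDerivAt (transR k) (transRDeriv k u) u := by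
  have h := ((hasDerivAt_logOdds h0 h1.le).pow k).const_sub 1
  have h2 : HasDerivAt (transR k) _ u := h.congr_of_eventuallyEq (by
    filter_upwards [lt_mem_nhds h0] with w hw
    exact if_pos hw)
  convert h2 using 1
  have hl := Real.log_neg h0 h1
  have hne : 1 - Real.log u ≠ 0 := by linarith
  obtain ⟨m, rfl⟩ := Nat.exists_eq_add_of_le' hk
  simp only [transRDeriv, if_pos h0, logOdds, Nat.add_sub_cancel, div_pow]
  field_simp
  ring

theorem transRDeriv_nonneg {k : ℕ} {u : ℝ} (h1 : u ≤ 1) : 0 ≤ transRDeriv k u := by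
  unfold transRDeriv
  split_ifs with h
  · have hl := Real.log_nonpos h.le h1
    exact div_nonneg (mul_nonneg k.cast_nonneg (pow_nonneg (by linarith) _))
      (mul_nonneg h.le (pow_nonneg (by linarith) _))
  · exact le_rfl

theorem measurable_transRDeriv (k : ℕ) : Measurable (transRDeriv k) := by
  unfold transRDeriv
  refine Measurable.ite measurableSet_Ioi ?_ measurable_const
  fun_prop

/-- The derivative is unbounded near 0; its integrability follows from its sign and the continuity
of the primitive up to the endpoints. -/
theorem lintegral_transRDeriv {k : ℕ} (hk : 1 ≤ k) {v : ℝ} (h0 : 0 ≤ v) (h1 : v ≤ 1) :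
    ∫⁻ u in Set.Ioc 0 v, ENNReal.ofReal (transRDeriv k u) = ENNReal.ofReal (transR k v) := by
  have hc : ContinuousOn (transR k) (Set.Icc 0 v) :=
    (continuousOn_transR k).mono (Set.Icc_subset_Icc_right h1)
  have hd : ∀ x ∈ Set.Ioo 0 v, HasDerivAt (transR k) (transRDeriv k x) x :=
    fun x hx => hasDerivAt_transR hk hx.1 (hx.2.trans_le h1)
  have hi := intervalIntegral.integrableOn_deriv_of_nonneg hc hd
    fun x hx => transRDeriv_nonneg (hx.2.le.trans h1)
  have h := intervalIntegral.integral_eq_sub_of_hasDerivAt_of_le h0 hc hd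
    ((intervalIntegrable_iff_integrableOn_Ioc_of_le h0).2 hi)
  rw [transR_zero, sub_zero, intervalIntegral.integral_of_le h0] at h
  rw [← h, ofReal_integral_eq_lintegral_ofReal hi]
  exact (ae_restrict_iff' measurableSet_Ioc).2
    (Eventually.of_forall fun x hx => transRDeriv_nonneg (hx.2.trans h1))

/-! ### The distribution function `R_k` and its density -/

theorem dfR_lt_one_iff {F : ℝ → ℝ} (hF : IsDF F) {k : ℕ} (hk : 1 ≤ k) (x : ℝ) :
    dfR F k x < 1 ↔ F x < 1 :=
  transR_lt_one_iff hk (hF.le_one x)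

theorem continuous_dfR {F : ℝ → ℝ} (hF : IsDF F) (hc : Continuous F) (k : ℕ) :
    Continuous (dfR F k) :=
  (continuousOn_transR k).comp_continuous hc fun x => ⟨hF.nonneg x, hF.le_one x⟩

theorem isDF_dfR {F : ℝ → ℝ} (hF : IsDF F) (hc : Continuous F) {k : ℕ} (hk : 1 ≤ k) :
    IsDF (dfR F k) where
  mono := fun x y hxy => transR_mono (hF.nonneg x) (hF.mono hxy) (hF.le_one y)
  right_cont := fun x => (continuous_dfR hF hc k).continuousWithinAt
  tendsto_atBot := by
    have h := continuousOn_transR k 0 ⟨le_rfl, zero_le_one⟩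
    rw [ContinuousWithinAt, transR_zero] at h
    exact h.comp (tendsto_nhdsWithin_iff.2
      ⟨hF.tendsto_atBot, Eventually.of_forall fun x => ⟨hF.nonneg x, hF.le_one x⟩⟩)
  tendsto_atTop := by
    have h := continuousOn_transR k 1 ⟨zero_le_one, le_rfl⟩
    rw [ContinuousWithinAt, transR_one hk] at h
    exact h.comp (tendsto_nhdsWithin_iff.2
      ⟨hF.tendsto_atTop, Eventually.of_forall fun x => ⟨hF.nonneg x, hF.le_one x⟩⟩)

/-! ### The density of `R_k` by the probability integral transform. -/

theorem IsPDF.withDensity_Iic {F f : ℝ → ℝ} (hf : IsPDF F f) (x : ℝ) :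
    volume.withDensity (fun t => ENNReal.ofReal (f t)) (Set.Iic x) = ENNReal.ofReal (F x) := by
  rw [withDensity_apply _ measurableSet_Iic, hf.eq_integral,
    ofReal_integral_eq_lintegral_ofReal hf.integrable.integrableOn
      (Eventually.of_forall hf.nonneg)]

/-- The probability integral transform: `F(X)` is uniformly distributed if `X` has the continuous
distribution function `F`. -/
theorem IsPDF.map_withDensity {F f : ℝ → ℝ} (hF : IsDF F) (hf : IsPDF F f) :
    (volume.withDensity fun t => ENNReal.ofReal (f t)).map F = volume.restrict (Set.Ioc 0 1) := by
  have hc := hf.continuous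
  have hfin : IsFiniteMeasure (volume.withDensity fun t => ENNReal.ofReal (f t)) :=
    isFiniteMeasure_withDensity_ofReal hf.integrable.2
  symm
  refine Measure.ext_of_Iic _ _ fun u => ?_
  rw [Measure.restrict_apply measurableSet_Iic, Measure.map_apply hc.measurable measurableSet_Iic]
  have hset : Set.Iic u ∩ Set.Ioc (0 : ℝ) 1 = Set.Ioc 0 (min u 1) := by
    ext x; simp only [Set.mem_inter_iff, Set.mem_Iic, Set.mem_Ioc, le_min_iff]; tauto
  rw [hset, Real.volume_Ioc, sub_zero]
  apply le_antisymm
  -- Points with `F x = w` are available only for `0 < w < 1`, so the mass is bounded below through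
  -- levels `w` strictly under `min u 1`.
  · refine le_of_forall_lt fun c hc' => ?_
    obtain ⟨w, hcw, hw⟩ := ENNReal.lt_iff_exists_real_btwn.1 hc' |>.imp fun _ h => h.2
    have hwpos : 0 ≤ w ∧ w < min u 1 := by
      rcases lt_or_ge w 0 with h | h
      · rw [ENNReal.ofReal_of_nonpos h.le] at hcw
        exact absurd hcw not_lt_zero
      · exact ⟨h, (ENNReal.ofReal_lt_ofReal_iff_of_nonneg h).1 hw⟩
    have hwpos' : 0 < w := by
      refine hwpos.1.lt_of_ne fun h => ?_
      rw [← h, ENNReal.ofReal_zero] at hcw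
      exact absurd hcw not_lt_zero
    obtain ⟨x, hx⟩ := hF.exists_eq hc hwpos' (hwpos.2.trans_le (min_le_right _ _))
    refine hcw.trans_le ?_
    rw [← hx, ← hf.withDensity_Iic]
    refine measure_mono fun t ht => ?_
    exact (hF.mono ht).trans (hx ▸ hwpos.2.le.trans (min_le_left _ _))
  · rcases lt_or_ge u 0 with h | h
    · have : F ⁻¹' Set.Iic u = ∅ :=
        Set.eq_empty_of_forall_notMem fun x hx => absurd (hF.nonneg x) (not_le.2 (lt_of_le_of_lt hx h))
      rw [this, measure_empty]
      exact zero_le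
    rcases le_or_gt 1 u with h1 | h1
    · rw [min_eq_right h1]
      have : ∀ x, volume.withDensity (fun t => ENNReal.ofReal (f t)) (Set.Iic x) ≤
          ENNReal.ofReal 1 := fun x => by
        rw [hf.withDensity_Iic]; exact ENNReal.ofReal_le_ofReal (hF.le_one x)
      exact (measure_mono (Set.subset_univ _)).trans
        (le_of_tendsto' (tendsto_measure_Iic_atTop _) this)
    · rw [min_eq_left h1.le]
      refine ENNReal.le_of_forall_pos_le_add fun ε hε _ => ?_
      -- A level strictly between `u` and 1, within `ε` of `u`: if `F x = w`, then `{F ≤ u}` lies to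
      -- the left of `x`.
      set w := min (u + ε) ((u + 1) / 2) with hw
      have hε' : (0 : ℝ) < ε := hε
      have huw : u < w := lt_min (by linarith) (by linarith)
      obtain ⟨x, hx⟩ := hF.exists_eq hc (h.trans_lt huw)
        ((min_le_right _ _).trans_lt (by linarith))
      calc _ ≤ volume.withDensity (fun t => ENNReal.ofReal (f t)) (Set.Iic x) := by
            refine measure_mono fun t ht => ?_
            by_contra! h3
            simp only [Set.mem_Iic, not_le] at h3
            exact absurd (hF.mono h3.le) (not_le.2 (lt_of_le_of_lt ht (hx ▸ huw)))
        _ = ENNReal.ofReal w := by rw [hf.withDensity_Iic, hx]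
        _ ≤ ENNReal.ofReal (u + ε) := ENNReal.ofReal_le_ofReal (min_le_left _ _)
        _ = _ := by rw [ENNReal.ofReal_add h hε'.le, ENNReal.ofReal_coe_nnreal]

/-- The substitution `u = F x` is made by pushing the measure forward, so `F` need not be
differentiated. -/
theorem lintegral_pdfR {F f : ℝ → ℝ} (hF : IsDF F) (hf : IsPDF F f) (k : ℕ) {v : ℝ}
    (hv : v ≤ 1) :
    ∫⁻ x in F ⁻¹' Set.Iic v, ENNReal.ofReal (pdfR F f k x) =
      ∫⁻ u in Set.Ioc 0 v, ENNReal.ofReal (transRDeriv k u) := by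
  have hc := hf.continuous
  have hfm : AEMeasurable (fun t => ENNReal.ofReal (f t)) := hf.integrable.1.aemeasurable.ennreal_ofReal
  have hg : Measurable fun u => ENNReal.ofReal (transRDeriv k u) :=
    (measurable_transRDeriv k).ennreal_ofReal
  have hg' : Measurable fun t => ENNReal.ofReal (transRDeriv k (F t)) := hg.comp hc.measurable
  have hms : MeasurableSet (F ⁻¹' Set.Iic v) := hc.measurable measurableSet_Iic
  have hset : Set.Ioc (0 : ℝ) v = Set.Iic v ∩ Set.Ioc (0 : ℝ) 1 := by
    ext x; simp only [Set.mem_inter_iff, Set.mem_Iic, Set.mem_Ioc]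
    exact ⟨fun h => ⟨h.2, h.1, h.2.trans hv⟩, fun h => ⟨h.2.1, h.1⟩⟩
  rw [hset, ← Measure.restrict_restrict measurableSet_Iic, ← hf.map_withDensity hF,
    Measure.restrict_map hc.measurable measurableSet_Iic, lintegral_map hg hc.measurable,
    restrict_withDensity hms, lintegral_withDensity_eq_lintegral_mul₀ hfm.restrict
      hg'.aemeasurable]
  refine lintegral_congr fun x => ?_
  rw [pdfR_eq, ENNReal.ofReal_mul (hf.nonneg x)]
  rfl

theorem isPDF_dfR {F f : ℝ → ℝ} (hF : IsDF F) (hf : IsPDF F f) {k : ℕ} (hk : 1 ≤ k) :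
    IsPDF (dfR F k) (pdfR F f k) := by
  have hc := hf.continuous
  have hfm : AEMeasurable (fun t => ENNReal.ofReal (f t)) := hf.integrable.1.aemeasurable.ennreal_ofReal
  have hnn : ∀ x, 0 ≤ pdfR F f k x := fun x => by
    rw [pdfR_eq]; exact mul_nonneg (hf.nonneg x) (transRDeriv_nonneg (hF.le_one x))
  have hmeas : AEStronglyMeasurable (pdfR F f k) := by
    rw [pdfR_eq]
    exact hf.integrable.1.mul
      ((measurable_transRDeriv k).comp hc.measurable).aestronglyMeasurable
  have hint : Integrable (pdfR F f k) := by
    refine ⟨hmeas, ?_⟩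
    rw [hasFiniteIntegral_iff_ofReal (Eventually.of_forall hnn)]
    have h := lintegral_pdfR hF hf k le_rfl
    have huniv : F ⁻¹' Set.Iic 1 = Set.univ := Set.eq_univ_of_forall hF.le_one
    rw [huniv, Measure.restrict_univ, lintegral_transRDeriv hk zero_le_one le_rfl] at h
    rw [h]; exact ENNReal.ofReal_lt_top
  refine ⟨hnn, hint, fun x => ?_⟩
  have hFx := hF.nonneg x
  have hRx : 0 ≤ dfR F k x := by
    have := transR_mono (k := k) le_rfl hFx (hF.le_one x)
    rwa [transR_zero] at this
  have hsub : Set.Iic x ⊆ F ⁻¹' Set.Iic (F x) := fun t ht => hF.mono ht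
  -- The two sets differ by a stretch on which `F` is constant, which carries no mass.
  have hae : Set.Iic x =ᵐ[volume.withDensity fun t => ENNReal.ofReal (f t)]
      F ⁻¹' Set.Iic (F x) := by
    refine ae_eq_of_subset_of_measure_ge hsub ?_ measurableSet_Iic.nullMeasurableSet ?_
    · rw [← Measure.map_apply hc.measurable measurableSet_Iic, hf.map_withDensity hF,
        hf.withDensity_Iic, Measure.restrict_apply measurableSet_Iic]
      calc _ ≤ volume (Set.Ioc 0 (F x)) := measure_mono fun t ht => ⟨ht.2.1, ht.1⟩
        _ = _ := by rw [Real.volume_Ioc, sub_zero]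
    · rw [← Measure.map_apply hc.measurable measurableSet_Iic, hf.map_withDensity hF]
      exact measure_ne_top _ _
  have hg : Measurable fun t => ENNReal.ofReal (transRDeriv k (F t)) :=
    ((measurable_transRDeriv k).comp hc.measurable).ennreal_ofReal
  have hconv : ∀ s, MeasurableSet s → ∫⁻ t in s, ENNReal.ofReal (pdfR F f k t) =
      ∫⁻ t in s, ENNReal.ofReal (transRDeriv k (F t))
        ∂(volume.withDensity fun t => ENNReal.ofReal (f t)) := fun s hs => by
    rw [restrict_withDensity hs, lintegral_withDensity_eq_lintegral_mul₀ hfm.restrict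
      hg.aemeasurable]
    refine lintegral_congr fun x => ?_
    rw [pdfR_eq, ENNReal.ofReal_mul (hf.nonneg x)]
    rfl
  rw [← ENNReal.toReal_ofReal hRx, integral_eq_lintegral_of_nonneg_ae
    (Eventually.of_forall hnn) hmeas.restrict, hconv _ measurableSet_Iic,
    setLIntegral_congr hae, ← hconv _ (hc.measurable measurableSet_Iic),
    lintegral_pdfR hF hf k (hF.le_one x), lintegral_transRDeriv hk hFx (hF.le_one x)]
  rfl

theorem one_sub_dfR {F : ℝ → ℝ} {k : ℕ} {x : ℝ} (h : 0 < F x) :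
    1 - dfR F k x = (1 - F x) ^ k * logOddsRatio (F x) ^ k := by
  simp only [dfR_eq, transR, if_pos h, logOdds_eq_mul, mul_pow]; ring

theorem tendsto_tail_dfR {F : ℝ → ℝ} (hF : IsDF F) (hc : Continuous F) (k : ℕ) :
    Tendsto (fun x => (1 - dfR F k x) / (1 - F x) ^ k) (toRightEnd F) (𝓝 1) := by
  have h := hF.tendsto_one hc
  have h1 := tendsto_nhds_of_tendsto_nhdsWithin h
  have h2 := (tendsto_logOddsRatio.comp h1).pow k
  rw [one_pow] at h2
  refine h2.congr' ?_
  filter_upwards [hF.eventually_lt_one, h1.eventually (lt_mem_nhds zero_lt_one)] with x hx h0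
  have : (1 - F x) ≠ 0 := by linarith
  rw [one_sub_dfR h0, mul_div_cancel_left₀ _ (pow_ne_zero k this)]
  rfl

theorem tailEquivalent_dfR_dfH {F : ℝ → ℝ} (hF : IsDF F) (hc : Continuous F) {k : ℕ}
    (hk : 1 ≤ k) : TailEquivalent (dfR F k) (dfH F k) := by
  have h1 : rightEnd (dfR F k) = rightEnd F := IsDF.rightEnd_eq_of_iff (dfR_lt_one_iff hF hk)
  refine ⟨IsDF.rightEnd_eq_of_iff fun x => ?_, 1, one_pos, ?_⟩
  · have h0 : 0 ≤ 1 - F x := sub_nonneg.2 (hF.le_one x)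
    rw [dfR_lt_one_iff hF hk, dfH, sub_lt_self_iff, ← sub_pos]
    refine ⟨fun h => pow_pos h k, fun h => h0.lt_of_ne fun h2 => ?_⟩
    rw [← h2, zero_pow (Nat.one_le_iff_ne_zero.1 hk)] at h
    exact lt_irrefl _ h
  · rw [toRightEnd, h1]
    simp only [dfH, sub_sub_cancel]
    exact tendsto_tail_dfR hF hc k

/-! ### Powers of distribution functions and tails -/

/-- Taking logarithms, `n log (u n) → -c`, hence `u n → 1`; then `1 - u` is squeezed between `-u log
u` and `-log u`. -/
theorem tendsto_mul_one_sub_of_tendsto_pow {u : ℕ → ℝ} {c : ℝ} (h0 : ∀ n, 0 ≤ u n)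
    (h : Tendsto (fun n => u n ^ n) atTop (𝓝 (Real.exp (-c)))) :
    Tendsto (fun n : ℕ => n * (1 - u n)) atTop (𝓝 c) := by
  have hlog : Tendsto (fun n : ℕ => n * Real.log (u n)) atTop (𝓝 (-c)) := by
    have := h.log (Real.exp_pos _).ne'
    rw [Real.log_exp] at this
    exact this.congr fun n => by rw [Real.log_pow]
  have hpos : ∀ᶠ n in atTop, 0 < u n := by
    filter_upwards [h.eventually (lt_mem_nhds (Real.exp_pos _)), eventually_ge_atTop 1] with n hn h1
    refine (h0 n).lt_of_ne fun h2 => ?_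
    rw [← h2, zero_pow (by omega)] at hn
    exact lt_irrefl _ hn
  have hlog0 : Tendsto (fun n : ℕ => Real.log (u n)) atTop (𝓝 0) := by
    have := hlog.mul tendsto_inv_atTop_nhds_zero_nat
    rw [mul_zero] at this
    refine this.congr' ?_
    filter_upwards [eventually_ge_atTop 1] with n hn
    have : (n : ℝ) ≠ 0 := by positivity
    field_simp
  have hu1 : Tendsto u atTop (𝓝 1) := by
    have := hlog0.rexp
    rw [Real.exp_zero] at this
    refine this.congr' ?_
    filter_upwards [hpos] with n hn using Real.exp_log hn
  have hup : Tendsto (fun n : ℕ => -(n * Real.log (u n))) atTop (𝓝 c) := by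
    simpa using hlog.neg
  have hlow : Tendsto (fun n : ℕ => u n * -(n * Real.log (u n))) atTop (𝓝 c) := by
    simpa using hu1.mul hup
  refine tendsto_of_tendsto_of_tendsto_of_le_of_le' hlow hup ?_ ?_
  · filter_upwards [hpos] with n hn
    have h1 := Real.one_sub_inv_le_log_of_pos hn
    have h2 : u n * (1 - (u n)⁻¹) ≤ u n * Real.log (u n) := by gcongr
    rw [mul_sub, mul_inv_cancel₀ hn.ne', mul_one] at h2
    have h3 : (n : ℝ) * (-(u n * Real.log (u n))) ≤ n * (1 - u n) :=
      mul_le_mul_of_nonneg_left (by linarith) n.cast_nonneg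
    linarith
  · filter_upwards [hpos] with n hn
    have h1 := Real.log_le_sub_one_of_pos hn
    have h3 : (n : ℝ) * (1 - u n) ≤ n * (-Real.log (u n)) :=
      mul_le_mul_of_nonneg_left (by linarith) n.cast_nonneg
    linarith

theorem tendsto_pow_of_tendsto_mul_one_sub {u : ℕ → ℝ} {c : ℝ}
    (h : Tendsto (fun n : ℕ => n * (1 - u n)) atTop (𝓝 c)) :
    Tendsto (fun n => u n ^ n) atTop (𝓝 (Real.exp (-c))) := by
  have := Real.tendsto_one_add_pow_exp_of_tendsto (g := fun n => u n - 1) (t := -c)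
    (by simpa [← mul_neg] using h.neg)
  simpa using this

/-! ### Convergence of tails along norming constants -/

/-- `n (1 - F (a n * x + b n)) → τ x` for `x ∈ D`, where `τ` is continuous and strictly decreasing
on the open set `D`. -/
structure TailConverges (F : ℝ → ℝ) (a b : ℕ → ℝ) (D : Set ℝ) (τ : ℝ → ℝ) : Prop where
  mono : Monotone F
  pos : ∀ᶠ n in atTop, 0 < a n
  isOpen : IsOpen D
  anti : StrictAntiOn τ D
  cont : ContinuousOn τ D
  tendsto : ∀ x ∈ D, Tendsto (fun n : ℕ => n * (1 - F (a n * x + b n))) atTop (𝓝 (τ x))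

namespace TailConverges

variable {F : ℝ → ℝ} {a b : ℕ → ℝ} {D : Set ℝ} {τ : ℝ → ℝ} {ι : Type*} {l : Filter ι}

/-- As `τ` is strictly decreasing, comparing the tail at `t i` with the tails at nearby `z ∈ D`
tells on which side of `z` the normalized point lies. The free index `N` serves both `n → ∞` and `t
↑ r(F)`. -/
theorem tendsto_normed (h : TailConverges F a b D τ) {N : ι → ℕ} (hN : Tendsto N l atTop)
    {t : ι → ℝ} {x : ℝ} (hx : x ∈ D)
    (ht : Tendsto (fun i => N i * (1 - F (t i))) l (𝓝 (τ x))) :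
    Tendsto (fun i => (t i - b (N i)) / a (N i)) l (𝓝 x) := by
  have hD : ∀ᶠ y in 𝓝 x, y ∈ D := h.isOpen.mem_nhds hx
  refine tendsto_order.2 ⟨fun y hy => ?_, fun y hy => ?_⟩
  · obtain ⟨z, ⟨hzD, hyz⟩, hzx⟩ := (((hD.filter_mono nhdsWithin_le_nhds).and
      ((lt_mem_nhds hy).filter_mono nhdsWithin_le_nhds)).and
        (self_mem_nhdsWithin (s := Set.Iio x))).exists
    have h1 := (h.tendsto z hzD).comp hN
    filter_upwards [ht.eventually_lt h1 (h.anti hzD hx hzx), hN.eventually h.pos] with i hi hpos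
    have h2 := lt_of_mul_lt_mul_left hi (N i).cast_nonneg
    have h3 : a (N i) * z + b (N i) < t i := by
      by_contra! h4
      have := h.mono h4
      linarith
    refine hyz.trans ?_
    rw [lt_div_iff₀ hpos]
    linarith
  · obtain ⟨z, ⟨hzD, hyz⟩, hzx⟩ := (((hD.filter_mono nhdsWithin_le_nhds).and
      ((gt_mem_nhds hy).filter_mono nhdsWithin_le_nhds)).and
        (self_mem_nhdsWithin (s := Set.Ioi x))).exists
    have h1 := (h.tendsto z hzD).comp hN
    filter_upwards [h1.eventually_lt ht (h.anti hx hzD hzx), hN.eventually h.pos] with i hi hpos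
    have h2 := lt_of_mul_lt_mul_left hi (N i).cast_nonneg
    have h3 : t i < a (N i) * z + b (N i) := by
      by_contra! h4
      have := h.mono h4
      linarith
    refine lt_trans ?_ hyz
    rw [div_lt_iff₀ hpos]
    linarith

/-- Monotonicity of `F` and continuity of `τ` extend the pointwise convergence to moving arguments.
-/
theorem tendsto_tail (h : TailConverges F a b D τ) {N : ι → ℕ} (hN : Tendsto N l atTop)
    {t : ι → ℝ} {x : ℝ} (hx : x ∈ D)
    (ht : Tendsto (fun i => (t i - b (N i)) / a (N i)) l (𝓝 x)) :
    Tendsto (fun i => N i * (1 - F (t i))) l (𝓝 (τ x)) := by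
  have hD : ∀ᶠ y in 𝓝 x, y ∈ D := h.isOpen.mem_nhds hx
  have hc : Tendsto τ (𝓝 x) (𝓝 (τ x)) := h.cont.continuousAt hD
  refine tendsto_order.2 ⟨fun y hy => ?_, fun y hy => ?_⟩
  · obtain ⟨z, ⟨hzD, hyz⟩, hzx⟩ := (((hD.filter_mono nhdsWithin_le_nhds).and
      ((hc.eventually (lt_mem_nhds hy)).filter_mono nhdsWithin_le_nhds)).and
        (self_mem_nhdsWithin (s := Set.Ioi x))).exists
    filter_upwards [((h.tendsto z hzD).comp hN).eventually (lt_mem_nhds hyz),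
      ht.eventually (gt_mem_nhds hzx), hN.eventually h.pos] with i hi hti hpos
    rw [div_lt_iff₀ hpos] at hti
    have h3 : t i ≤ a (N i) * z + b (N i) := by linarith
    refine lt_of_lt_of_le hi (mul_le_mul_of_nonneg_left ?_ (N i).cast_nonneg)
    linarith [h.mono h3]
  · obtain ⟨z, ⟨hzD, hyz⟩, hzx⟩ := (((hD.filter_mono nhdsWithin_le_nhds).and
      ((hc.eventually (gt_mem_nhds hy)).filter_mono nhdsWithin_le_nhds)).and
        (self_mem_nhdsWithin (s := Set.Iio x))).exists
    filter_upwards [((h.tendsto z hzD).comp hN).eventually (gt_mem_nhds hyz),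
      ht.eventually (lt_mem_nhds hzx), hN.eventually h.pos] with i hi hti hpos
    rw [lt_div_iff₀ hpos] at hti
    have h3 : a (N i) * z + b (N i) ≤ t i := by linarith
    refine lt_of_le_of_lt (mul_le_mul_of_nonneg_left ?_ (N i).cast_nonneg) hi
    linarith [h.mono h3]

/-- Convergence of types: changing the index by an asymptotic factor `c` changes the norming
constants by the affine map that divides `τ` by `c`. -/
theorem tendsto_types (h : TailConverges F a b D τ) {M N : ι → ℕ} (hM : Tendsto M l atTop)
    (hN : Tendsto N l atTop) {c κ θ : ℝ} (hc : c ≠ 0)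
    (hMN : Tendsto (fun i => (M i : ℝ) / N i) l (𝓝 c)) (hD : D.Nonempty)
    (hmaps : ∀ x ∈ D, κ * x + θ ∈ D) (hτ : ∀ x ∈ D, τ (κ * x + θ) = τ x / c) :
    Tendsto (fun i => a (M i) / a (N i)) l (𝓝 κ) ∧
      Tendsto (fun i => (b (M i) - b (N i)) / a (N i)) l (𝓝 θ) := by
  have key : ∀ x ∈ D, Tendsto
      (fun i => (a (M i) * x + b (M i) - b (N i)) / a (N i)) l (𝓝 (κ * x + θ)) := fun x hx => by
    refine h.tendsto_normed hN (hmaps x hx) ?_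
    rw [hτ x hx]
    refine (((h.tendsto x hx).comp hM).div hMN hc).congr' ?_
    filter_upwards [hM.eventually_gt_atTop 0, hN.eventually_gt_atTop 0] with i h1 h2
    have h1' : (M i : ℝ) ≠ 0 := by positivity
    have h2' : (N i : ℝ) ≠ 0 := by positivity
    simp only [Pi.div_apply, Function.comp_apply]
    field_simp
  -- Two distinct points of `D` separate the slope of the affine limit from its intercept.
  obtain ⟨x, hx⟩ := hD
  have hDx : ∀ᶠ y in 𝓝 x, y ∈ D := h.isOpen.mem_nhds hx
  obtain ⟨y, hyD, hy⟩ := ((hDx.filter_mono nhdsWithin_le_nhds).and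
    (self_mem_nhdsWithin (s := Set.Ioi x))).exists
  have hyx : y - x ≠ 0 := sub_ne_zero.2 (ne_of_gt hy)
  have h1 : Tendsto (fun i => a (M i) / a (N i)) l (𝓝 κ) := by
    have h2 := ((key y hyD).sub (key x hx)).div_const (y - x)
    have h3 : (κ * y + θ - (κ * x + θ)) / (y - x) = κ := by field_simp; ring
    rw [h3] at h2
    refine h2.congr fun i => ?_
    rw [← sub_div, div_div, mul_comm (a (N i)), ← div_div]
    congr 1
    rw [div_eq_iff hyx]; ring
  refine ⟨h1, ?_⟩
  have h2 := (key x hx).sub (h1.mul_const x)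
  rw [add_sub_cancel_left] at h2
  refine h2.congr fun i => ?_
  ring

/-- Only centres near the right extremity have small tails. -/
theorem eventually_lt_of_lt_one (h : TailConverges F a b D τ) {x : ℝ} (hx : x ∈ D) {y : ℝ}
    (hy : F y < 1) : ∀ᶠ n in atTop, y < a n * x + b n := by
  have h1 : Tendsto (fun n : ℕ => n * (1 - F y)) atTop atTop :=
    tendsto_natCast_atTop_atTop.atTop_mul_const (by linarith)
  filter_upwards [h1.eventually_ge_atTop (τ x + 1),
    (h.tendsto x hx).eventually (gt_mem_nhds (lt_add_one (τ x)))] with n h2 h3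
  by_contra! h4
  have h5 : (n : ℝ) * (1 - F y) ≤ n * (1 - F (a n * x + b n)) :=
    mul_le_mul_of_nonneg_left (by linarith [h.mono h4]) n.cast_nonneg
  linarith

end TailConverges

/-! ### Two recursive estimates -/

/-- For `max c₀ 0 < q < 1` the error is eventually below `ε / 2 * (1 - q)`, so the bound on the
excess of `u` over `ε / 2` shrinks by `q` at each halving of the index. -/
theorem tendsto_zero_of_le_half {u c e : ℕ → ℝ} {c₀ : ℝ} (h0 : ∀ n, 0 ≤ u n)
    (h : ∀ᶠ n in atTop, u n ≤ c n * u (n / 2) + e n) (hc : Tendsto c atTop (𝓝 c₀))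
    (hc₀ : c₀ < 1) (he : Tendsto e atTop (𝓝 0)) : Tendsto u atTop (𝓝 0) := by
  obtain ⟨q, hq, hq1⟩ := exists_between (max_lt hc₀ zero_lt_one)
  have hq0 : 0 < q := (le_max_right _ _).trans_lt hq
  refine tendsto_order.2 ⟨fun y hy => Eventually.of_forall fun n => hy.trans_le (h0 n),
    fun ε hε => ?_⟩
  have hstep : ∀ᶠ n in atTop, u n ≤ q * u (n / 2) + ε / 2 * (1 - q) := by
    filter_upwards [h, hc.eventually (gt_mem_nhds ((le_max_left _ _).trans_lt hq)),
      he.eventually (gt_mem_nhds (show 0 < ε / 2 * (1 - q) from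
        mul_pos (half_pos hε) (by linarith)))] with n h1 h2 h3
    have := mul_le_mul_of_nonneg_right h2.le (h0 (n / 2))
    linarith
  obtain ⟨N, hN⟩ := eventually_atTop.1 hstep
  obtain ⟨B, hB⟩ : ∃ B : ℝ, ∀ n ≤ N, u n ≤ B :=
    ⟨∑ n ∈ Finset.range (N + 1), u n, fun n hn =>
      Finset.single_le_sum (f := u) (fun i _ => h0 i) (Finset.mem_range.2 (by omega))⟩
  have hB0 : 0 ≤ B := (h0 0).trans (hB 0 (Nat.zero_le _))
  have hbound : ∀ n, u n ≤ B + ε / 2 := by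
    intro n
    induction n using Nat.strong_induction_on with
    | _ n ih =>
      rcases le_or_gt n N with hn | hn
      · linarith [hB n hn]
      · have h1 := hN n hn.le
        have h2 := mul_le_mul_of_nonneg_left (ih (n / 2) (by omega)) hq0.le
        nlinarith
  -- Such an `n` can be halved `j` times while staying beyond `N`.
  have hdecay : ∀ j n, 2 ^ j * (N + 1) ≤ n → u n ≤ q ^ j * B + ε / 2 := by
    intro j
    induction j with
    | zero => intro n _; simpa using hbound n
    | succ j ih =>
      intro n hn
      have hn2 : 2 ^ j * (N + 1) * 2 ≤ n := by rw [pow_succ] at hn; linarith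
      have hNn : N ≤ n := by
        have : 1 ≤ 2 ^ j := Nat.one_le_two_pow
        nlinarith
      have h1 := hN n hNn
      have h2 := mul_le_mul_of_nonneg_left (ih (n / 2) ((Nat.le_div_iff_mul_le two_pos).2 hn2)) hq0.le
      rw [pow_succ]
      nlinarith
  have hlim : Tendsto (fun j : ℕ => q ^ j * B + ε / 2) atTop (𝓝 (0 * B + ε / 2)) :=
    ((tendsto_pow_atTop_nhds_zero_of_lt_one hq0.le hq1).mul_const B).add_const _
  obtain ⟨j, hj⟩ := (hlim.eventually (gt_mem_nhds (show 0 * B + ε / 2 < ε by linarith))).exists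
  filter_upwards [eventually_ge_atTop (2 ^ j * (N + 1))] with n hn
  exact (hdecay j n hn).trans_lt hj

/-- The increments of `b` are dominated by a geometric series `ε (1 - c) c^i a n` with sum `ε a n`.
-/
theorem le_add_of_doubling {a b : ℕ → ℝ} {c ε : ℝ} {N : ℕ}
    (hb : ∀ n ≥ N, b (2 * n) ≤ b n + ε * (1 - c) * a n) (ha : ∀ n ≥ N, a (2 * n) ≤ c * a n)
    (hpos : ∀ n ≥ N, 0 ≤ a n) (hε : 0 ≤ ε) (j : ℕ) :
    ∀ n ≥ N, b (2 ^ j * n) ≤ b n + ε * a n := by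
  induction j with
  | zero =>
    intro n hn
    have := mul_nonneg hε (hpos n hn)
    simpa using this
  | succ j ih =>
    intro n hn
    have h1 := ih (2 * n) (by omega)
    rw [← mul_assoc, ← pow_succ] at h1
    have h2 := mul_le_mul_of_nonneg_left (ha n hn) hε
    linarith [hb n hn]

/-! ### From convergence of powers to convergence of tails. -/

theorem MaxConverges.tailConverges {F G : ℝ → ℝ} {a b : ℕ → ℝ} (hF : IsDF F)
    (h : MaxConverges F a b G) {D : Set ℝ} {τ : ℝ → ℝ} (hD : IsOpen D) (hanti : StrictAntiOn τ D)
    (hcont : ContinuousOn τ D) (hG : ∀ x ∈ D, G x = Real.exp (-τ x)) :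
    TailConverges F a b D τ where
  mono := hF.mono
  pos := h.1
  isOpen := hD
  anti := hanti
  cont := hcont
  tendsto := fun x hx => by
    have hGx : ContinuousAt G x := by
      have h1 : ContinuousAt (fun x => Real.exp (-τ x)) x :=
        (hcont.continuousAt (hD.mem_nhds hx)).neg.rexp
      refine h1.congr ?_
      filter_upwards [hD.mem_nhds hx] with y hy using (hG y hy).symm
    refine tendsto_mul_one_sub_of_tendsto_pow (fun n => hF.nonneg _) ?_
    rw [← hG x hx]
    exact h.2 x hGx

/-! ### The Fréchet domain -/

theorem MaxConverges.tailConverges_frechet {F : ℝ → ℝ} {a b : ℕ → ℝ} {α : ℝ} (hF : IsDF F)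
    (hα : 0 < α) (h : MaxConverges F a b (frechet α)) :
    TailConverges F a b (Set.Ioi 0) (fun x => x ^ (-α)) := by
  refine h.tailConverges hF isOpen_Ioi ?_ ?_ fun x hx => if_pos hx
  · intro x hx y hy hxy
    exact Real.rpow_lt_rpow_of_neg hx hxy (neg_lt_zero.2 hα)
  · intro x hx
    exact (Real.continuousAt_rpow_const x (-α) (Or.inl (ne_of_gt hx))).continuousWithinAt

theorem tendsto_natCast_div_half :
    Tendsto (fun n : ℕ => (n : ℝ) / (n / 2 : ℕ)) atTop (𝓝 2) := by
  have h := ((tendsto_nat_floor_mul_div_atTop (R := ℝ) (a := 1 / 2) (by norm_num)).comp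
    tendsto_natCast_atTop_atTop).inv₀ (by norm_num)
  have h2 : ((1 : ℝ) / 2)⁻¹ = 2 := by norm_num
  rw [h2] at h
  refine h.congr fun n => ?_
  have h3 : ⌊(1 : ℝ) / 2 * (n : ℝ)⌋₊ = n / 2 := by
    rw [← Nat.floor_div_eq_div (K := ℝ)]; congr 1; push_cast; ring
  simp only [Function.comp_apply, h3, inv_div]

theorem tendsto_half_atTop : Tendsto (fun n : ℕ => n / 2) atTop atTop :=
  Nat.tendsto_div_const_atTop two_ne_zero

/-- Comparing `n` with `n / 2` gives `a n / a (n / 2) → κ > 1` and a negligible shift of `b`. Hence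
both `|b n / a n|` and `|(a n)⁻¹|` satisfy the halving recursion with limiting factor `κ⁻¹`. -/
theorem TailConverges.frechet_constants {F : ℝ → ℝ} {a b : ℕ → ℝ} {α : ℝ} (hα : 0 < α)
    (h : TailConverges F a b (Set.Ioi 0) (fun x => x ^ (-α))) :
    Tendsto (fun n => b n / a n) atTop (𝓝 0) ∧ Tendsto a atTop atTop := by
  -- The solution of `(κ x)^(-α) = x^(-α) / 2`.
  set κ : ℝ := 2 ^ (1 / α) with hκ
  have hκ1 : 1 < κ := Real.one_lt_rpow one_lt_two (by positivity)
  have hκ0 : 0 < κ := zero_lt_one.trans hκ1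
  obtain ⟨h1, h2⟩ := h.tendsto_types (M := id) (N := fun n => n / 2) tendsto_id
    tendsto_half_atTop (c := 2) (κ := κ) (θ := 0) two_ne_zero tendsto_natCast_div_half
    ⟨1, Set.mem_Ioi.2 one_pos⟩ (fun x hx => by rw [add_zero]; exact mul_pos hκ0 hx) (fun x hx => by
      rw [add_zero, Real.mul_rpow hκ0.le (le_of_lt hx), hκ, ← Real.rpow_mul two_pos.le]
      have : 1 / α * -α = -1 := by field_simp
      rw [this, Real.rpow_neg_one]; ring)
  simp only [id] at h1 h2
  have hinv : Tendsto (fun n => a (n / 2) / a n) atTop (𝓝 κ⁻¹) :=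
    (h1.inv₀ hκ0.ne').congr fun n => inv_div _ _
  have hpos2 := tendsto_half_atTop.eventually h.pos
  constructor
  · have h3 := (h2.abs.mul hinv)
    rw [abs_zero, zero_mul] at h3
    refine (tendsto_zero_iff_abs_tendsto_zero _).2
      (tendsto_zero_of_le_half (fun n => abs_nonneg _) ?_ hinv (inv_lt_one_of_one_lt₀ hκ1) h3)
    filter_upwards [h.pos, hpos2] with n hn hn2
    have h4 : b n / a n = a (n / 2) / a n * (b (n / 2) / a (n / 2)) +
        (b n - b (n / 2)) / a (n / 2) * (a (n / 2) / a n) := by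
      field_simp; ring
    calc |b n / a n| = |a (n / 2) / a n * (b (n / 2) / a (n / 2)) +
        (b n - b (n / 2)) / a (n / 2) * (a (n / 2) / a n)| := by rw [← h4]
      _ ≤ _ := (abs_add_le _ _).trans_eq (by
        rw [abs_mul, abs_mul, abs_of_pos (div_pos hn2 hn)]; rfl)
  · have h5 : Tendsto (fun n => |(a n)⁻¹|) atTop (𝓝 0) := by
      refine tendsto_zero_of_le_half (fun n => abs_nonneg _) ?_ hinv (inv_lt_one_of_one_lt₀ hκ1)
        (tendsto_const_nhds (x := (0 : ℝ)))
      filter_upwards [h.pos, hpos2] with n hn hn2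
      rw [abs_of_pos (inv_pos.2 hn), abs_of_pos (inv_pos.2 hn2), add_zero]
      refine le_of_eq ?_
      field_simp
    have h6 : Tendsto (fun n => (a n)⁻¹) atTop (𝓝[>] 0) :=
      tendsto_nhdsWithin_iff.2 ⟨(tendsto_zero_iff_abs_tendsto_zero _).2 h5,
        h.pos.mono fun n hn => inv_pos.2 hn⟩
    exact (tendsto_inv_nhdsGT_zero.comp h6).congr fun n => inv_inv _

/-- The points `a n + b n` tend to infinity, yet `n` times their tail has a positive limit. -/
theorem TailConverges.frechet_lt_one {F : ℝ → ℝ} {a b : ℕ → ℝ} {α : ℝ} (hF : IsDF F) (hα : 0 < α)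
    (h : TailConverges F a b (Set.Ioi 0) (fun x => x ^ (-α))) (y : ℝ) : F y < 1 := by
  obtain ⟨h1, h2⟩ := h.frechet_constants hα
  have h3 : Tendsto (fun n => a n * (1 + b n / a n)) atTop atTop := by
    refine h2.atTop_mul_pos (C := 1) one_pos ?_
    simpa using h1.const_add 1
  have h4 := h.tendsto 1 (Set.mem_Ioi.2 one_pos)
  have h5 : (0 : ℝ) < (1 : ℝ) ^ (-α) := by rw [Real.one_rpow]; exact one_pos
  obtain ⟨n, ⟨hn, hn2⟩, hn3⟩ := ((h3.eventually_ge_atTop y).and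
    (h4.eventually (lt_mem_nhds h5))|>.and h.pos).exists
  have h6 : a n * (1 + b n / a n) = a n * 1 + b n := by field_simp
  rw [h6] at hn
  have h7 := hF.mono hn
  by_contra! h8
  have h9 : (n : ℝ) * (1 - F (a n * 1 + b n)) ≤ 0 :=
    mul_nonpos_of_nonneg_of_nonpos n.cast_nonneg (by linarith)
  linarith

/-! ### The Weibull domain -/

theorem MaxConverges.tailConverges_weibull {F : ℝ → ℝ} {a b : ℕ → ℝ} {α : ℝ} (hF : IsDF F)
    (hα : 0 < α) (h : MaxConverges F a b (weibull α)) :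
    TailConverges F a b (Set.Iio 0) (fun x => |x| ^ α) := by
  refine h.tailConverges hF isOpen_Iio ?_ ?_ fun x hx => if_pos hx
  · intro x hx y hy hxy
    refine Real.rpow_lt_rpow (abs_nonneg _) ?_ hα
    rw [abs_of_neg (show x < 0 from hx), abs_of_neg (show y < 0 from hy)]
    linarith
  · exact (continuous_abs.rpow_const fun _ => Or.inr hα.le).continuousOn

/-- Doubling the index contracts `a` by a factor near `κ < 1`, so `b (2^j n)` never passes `b n + ε
a n`. Were `F` below 1 there, `b m - a m` would pass that point for all large `m`, in particular for
some `m = 2^j n`. -/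
theorem TailConverges.weibull_eq_one {F : ℝ → ℝ} {a b : ℕ → ℝ} {α : ℝ} (hF : IsDF F)
    (hα : 0 < α) (h : TailConverges F a b (Set.Iio 0) (fun x => |x| ^ α)) {ε : ℝ} (hε : 0 < ε) :
    ∀ᶠ n in atTop, F (b n + ε * a n) = 1 := by
  set κ : ℝ := 2 ^ (-(1 / α)) with hκ
  have hκ1 : κ < 1 := Real.rpow_lt_one_of_one_lt_of_neg one_lt_two (by
    rw [neg_lt_zero]; positivity)
  have hκ0 : 0 < κ := Real.rpow_pos_of_pos two_pos _
  have hdouble : Tendsto (fun n : ℕ => 2 * n) atTop atTop :=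
    tendsto_id.const_mul_atTop' two_pos
  obtain ⟨h1, h2⟩ := h.tendsto_types (M := fun n => 2 * n) (N := id) hdouble tendsto_id (c := 2)
    (κ := κ) (θ := 0) two_ne_zero (by
      refine tendsto_const_nhds.congr' ?_
      filter_upwards [eventually_gt_atTop 0] with n hn
      have : (n : ℝ) ≠ 0 := by positivity
      simp only [id, Nat.cast_mul, Nat.cast_ofNat]
      field_simp)
    ⟨-1, by simp⟩ (fun x hx => by rw [add_zero]; exact mul_neg_of_pos_of_neg hκ0 hx) (fun x hx => by
      rw [add_zero, abs_mul, abs_of_pos hκ0, Real.mul_rpow hκ0.le (abs_nonneg _), hκ,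
        ← Real.rpow_mul two_pos.le]
      have : -(1 / α) * α = -1 := by field_simp
      rw [this, Real.rpow_neg_one]; ring)
  simp only [id] at h1 h2
  obtain ⟨c, hκc, hc1⟩ := exists_between hκ1
  have hδ : 0 < ε * (1 - c) := mul_pos hε (by linarith)
  obtain ⟨N, hN⟩ := eventually_atTop.1 ((h1.eventually (gt_mem_nhds hκc)).and
    ((h2.eventually (gt_mem_nhds hδ)).and h.pos))
  filter_upwards [eventually_ge_atTop N, eventually_gt_atTop 0] with n hn hn0
  refine le_antisymm (hF.le_one _) ?_
  by_contra! hlt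
  have hpow : Tendsto (fun j : ℕ => 2 ^ j * n) atTop atTop :=
    (tendsto_pow_atTop_atTop_of_one_lt one_lt_two).atTop_mul_const' hn0
  obtain ⟨j, hj⟩ := (hpow.eventually
    (h.eventually_lt_of_lt_one (x := -1) (by simp) hlt)).exists
  have hle := le_add_of_doubling (a := a) (b := b) (c := c) (ε := ε) (N := N)
    (fun m hm => by
      have := (div_lt_iff₀ (hN m hm).2.2).1 (hN m hm).2.1
      linarith)
    (fun m hm => ((div_lt_iff₀ (hN m hm).2.2).1 (hN m hm).1).le)
    (fun m hm => (hN m hm).2.2.le) hε.le j n hn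
  have hge : N ≤ 2 ^ j * n := hn.trans (Nat.le_mul_of_pos_left n (by positivity))
  linarith [(hN _ hge).2.2]

theorem TailConverges.weibull_rightEnd {F : ℝ → ℝ} {a b : ℕ → ℝ} {α : ℝ} (hF : IsDF F)
    (hα : 0 < α) (h : TailConverges F a b (Set.Iio 0) (fun x => |x| ^ α)) :
    rightEnd F < ⊤ ∧ Tendsto (fun n => ((rightEnd F).toReal - b n) / a n) atTop (𝓝 0) := by
  have htop : rightEnd F < ⊤ := by
    obtain ⟨n, hn⟩ := (h.weibull_eq_one hF hα one_pos).exists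
    refine lt_of_le_of_lt (not_lt.1 fun hlt => ?_) (EReal.coe_lt_top (b n + 1 * a n))
    exact absurd (hF.coe_lt_rightEnd.1 hlt) (by rw [hn]; exact lt_irrefl _)
  refine ⟨htop, ?_⟩
  have hr : ((rightEnd F).toReal : EReal) = rightEnd F :=
    EReal.coe_toReal htop.ne hF.bot_lt_rightEnd.ne'
  have hiff : ∀ t : ℝ, F t < 1 ↔ t < (rightEnd F).toReal := fun t => by
    rw [← hF.coe_lt_rightEnd, ← EReal.coe_lt_coe_iff, hr]
  refine tendsto_order.2 ⟨fun y hy => ?_, fun y hy => ?_⟩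
  · have h1 := h.tendsto y hy
    have h2 : 0 < |y| ^ α := Real.rpow_pos_of_pos (abs_pos.2 hy.ne) _
    filter_upwards [h1.eventually (lt_mem_nhds h2), h.pos] with n hn hpos
    have h3 : F (a n * y + b n) < 1 := by
      by_contra! h4
      have h5 : (n : ℝ) * (1 - F (a n * y + b n)) ≤ 0 :=
        mul_nonpos_of_nonneg_of_nonpos n.cast_nonneg (by linarith)
      linarith
    rw [hiff] at h3
    rw [lt_div_iff₀ hpos]
    linarith
  -- Half of `y` leaves room for the strict inequality.
  · filter_upwards [h.weibull_eq_one hF hα (half_pos hy), h.pos] with n hn hpos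
    have h3 : ¬ F (b n + y / 2 * a n) < 1 := by rw [hn]; exact lt_irrefl _
    rw [hiff, not_lt] at h3
    rw [div_lt_iff₀ hpos]
    nlinarith

/-! ### Norming `R_k` -/

/-- The integer part of the `k`-th root of `n`. -/
def rootFloor (k n : ℕ) : ℕ := ⌊(n : ℝ) ^ (1 / (k : ℝ))⌋₊

theorem tendsto_root {k : ℕ} (hk : 1 ≤ k) :
    Tendsto (fun n : ℕ => (n : ℝ) ^ (1 / (k : ℝ))) atTop atTop :=
  (tendsto_rpow_atTop (by positivity)).comp tendsto_natCast_atTop_atTop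

theorem tendsto_rootFloor {k : ℕ} (hk : 1 ≤ k) : Tendsto (rootFloor k) atTop atTop :=
  tendsto_nat_floor_atTop.comp (tendsto_root hk)

theorem tendsto_rootFloor_div {k : ℕ} (hk : 1 ≤ k) :
    Tendsto (fun n : ℕ => (rootFloor k n : ℝ) / (n : ℝ) ^ (1 / (k : ℝ))) atTop (𝓝 1) :=
  (tendsto_nat_floor_div_atTop (R := ℝ)).comp (tendsto_root hk)

/-- The constants of `F` have integer indices; rounding `n^(1/k)` does not affect limits. -/
theorem tendsto_rootFloor_mul_iff {k : ℕ} (hk : 1 ≤ k) {u : ℕ → ℝ} {c : ℝ} :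
    Tendsto (fun n : ℕ => (rootFloor k n : ℝ) * u n) atTop (𝓝 c) ↔
      Tendsto (fun n : ℕ => (n : ℝ) ^ (1 / (k : ℝ)) * u n) atTop (𝓝 c) := by
  have h := tendsto_rootFloor_div hk
  constructor
  · intro hu
    have h2 := hu.div h one_ne_zero
    rw [div_one] at h2
    refine h2.congr' ?_
    filter_upwards [(tendsto_rootFloor hk).eventually_gt_atTop 0,
      (tendsto_root hk).eventually_gt_atTop 0] with n h3 h4
    have h3' : (rootFloor k n : ℝ) ≠ 0 := by positivity
    simp only [Pi.div_apply]
    field_simp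
  · intro hu
    have h2 := hu.mul h
    rw [mul_one] at h2
    refine h2.congr' ?_
    filter_upwards [(tendsto_root hk).eventually_gt_atTop 0] with n h4
    field_simp

/-- The `k`-th power of `n^(1/k) (1 - F) → τ x` is `n (1 - F)^k → (τ x)^k`, and the factor
`logOddsRatio (F (t n))^k` tends to 1. -/
theorem TailConverges.tendsto_dfR_pow {F : ℝ → ℝ} {a b : ℕ → ℝ} {D : Set ℝ} {τ : ℝ → ℝ}
    (h : TailConverges F a b D τ) {k : ℕ} (hk : 1 ≤ k) {t : ℕ → ℝ} {x : ℝ} (hx : x ∈ D)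
    (ht : Tendsto (fun n => (t n - b (rootFloor k n)) / a (rootFloor k n)) atTop (𝓝 x)) :
    Tendsto (fun n => dfR F k (t n) ^ n) atTop (𝓝 (Real.exp (-τ x ^ k))) := by
  refine tendsto_pow_of_tendsto_mul_one_sub ?_
  have h1 := (tendsto_rootFloor_mul_iff hk).1 (h.tendsto_tail (tendsto_rootFloor hk) hx ht)
  have hF1 : Tendsto (fun n => F (t n)) atTop (𝓝 1) := by
    have h2 := ((h1.mul (tendsto_inv_atTop_zero.comp (tendsto_root hk)))).const_sub 1
    rw [mul_zero, sub_zero] at h2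
    refine h2.congr' ?_
    filter_upwards [(tendsto_root hk).eventually_gt_atTop 0] with n hn
    simp only [Function.comp_apply]
    field_simp
    ring
  have h3 := (h1.mul (tendsto_logOddsRatio.comp hF1)).pow k
  rw [mul_one] at h3
  refine h3.congr' ?_
  filter_upwards [hF1.eventually (lt_mem_nhds one_pos)] with n hn
  rw [one_sub_dfR hn, mul_pow, mul_pow, ← Real.rpow_natCast, ← Real.rpow_mul n.cast_nonneg,
    one_div_mul_cancel (by positivity), Real.rpow_one, mul_assoc]
  rfl

/-- The quantiles `F⁻(1 - (1/n)^(1/k))` are asymptotically `a (N n) * x + b (N n)` with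
`τ x = 1` and `N n ∼ n^(1/k)`. -/
theorem TailConverges.tendsto_quantile {F : ℝ → ℝ} {a b : ℕ → ℝ} {D : Set ℝ} {τ : ℝ → ℝ}
    (h : TailConverges F a b D τ) (hF : IsDF F) (hc : Continuous F) {k : ℕ} (hk : 1 ≤ k) {x : ℝ}
    (hx : x ∈ D) (hτ : τ x = 1) :
    Tendsto (fun n : ℕ => (quantile F (1 - (1 / (n : ℝ)) ^ (1 / (k : ℝ))) - b (rootFloor k n)) /
      a (rootFloor k n)) atTop (𝓝 x) := by
  refine h.tendsto_normed (tendsto_rootFloor hk) hx ?_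
  rw [tendsto_rootFloor_mul_iff hk, hτ]
  refine tendsto_const_nhds.congr' ?_
  filter_upwards [eventually_gt_atTop 1] with n hn
  have hn0 : (0 : ℝ) < n := by positivity
  have hn1 : (1 : ℝ) < n := by exact_mod_cast hn
  have hk0 : (0 : ℝ) < 1 / (k : ℝ) := by positivity
  have h1 : (1 / (n : ℝ)) ^ (1 / (k : ℝ)) < 1 :=
    Real.rpow_lt_one (by positivity) ((div_lt_one hn0).2 hn1) hk0
  have h2 : 0 < (1 / (n : ℝ)) ^ (1 / (k : ℝ)) := Real.rpow_pos_of_pos (by positivity) _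
  rw [hF.apply_quantile hc (by linarith) (by linarith), sub_sub_cancel,
    ← Real.mul_rpow hn0.le (by positivity), mul_one_div_cancel hn0.ne', Real.one_rpow]

theorem maxConverges_dfR_frechet {F : ℝ → ℝ} {α : ℝ} (hF : IsDF F) (hc : Continuous F) {k : ℕ}
    (hk : 1 ≤ k) (hα : 0 < α) (h : InMaxDomain F (frechet α)) :
    rightEnd F = ⊤ ∧ MaxConverges (dfR F k)
      (fun n => quantile F (1 - (1 / (n : ℝ)) ^ (1 / (k : ℝ)))) (fun _ => 0)
      (frechet (k * α)) := by
  obtain ⟨a, b, hab⟩ := h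
  have h := hab.tailConverges_frechet hF hα
  have hlt := h.frechet_lt_one hF hα
  have hR := isDF_dfR hF hc hk
  have hb := ((h.frechet_constants hα).1).comp (tendsto_rootFloor hk)
  have hpos := (tendsto_rootFloor hk).eventually h.pos
  have hq : Tendsto (fun n : ℕ => quantile F (1 - (1 / (n : ℝ)) ^ (1 / (k : ℝ))) /
      a (rootFloor k n)) atTop (𝓝 1) := by
    -- Here `τ 1 = 1`, so the quantile is asymptotic to `a N + b N`, and `b N / a N → 0`.
    have h1 := (h.tendsto_quantile hF hc hk (x := 1) (Set.mem_Ioi.2 one_pos)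
      (Real.one_rpow _)).add hb
    rw [add_zero] at h1
    refine h1.congr fun n => ?_
    simp only [Function.comp_apply]
    ring
  have hqpos : ∀ᶠ n : ℕ in atTop, 0 < quantile F (1 - (1 / (n : ℝ)) ^ (1 / (k : ℝ))) := by
    filter_upwards [hq.eventually (lt_mem_nhds one_pos), hpos] with n h1 h2
    have := mul_pos h1 h2
    rwa [div_mul_cancel₀ _ h2.ne'] at this
  refine ⟨(EReal.eq_top_iff_forall_lt _).2 fun y => hF.coe_lt_rightEnd.2 (hlt y), hqpos,
    fun x _ => ?_⟩
  simp only [add_zero]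
  rcases lt_or_ge 0 x with hx | hx
  · have h1 := h.tendsto_dfR_pow hk (x := x)
      (t := fun n : ℕ => quantile F (1 - (1 / (n : ℝ)) ^ (1 / (k : ℝ))) * x) hx (by
        have h2 := (hq.mul_const x).sub hb
        rw [one_mul, sub_zero] at h2
        refine h2.congr fun n => ?_
        simp only [Function.comp_apply]
        ring)
    rw [frechet, if_pos hx]
    rwa [← Real.rpow_natCast (x ^ (-α)), ← Real.rpow_mul hx.le, neg_mul, mul_comm α] at h1
  -- For `x ≤ 0` the powers are at most `R_k(0)^n`, with `R_k(0) < 1`.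
  · rw [frechet, if_neg (not_lt.2 hx)]
    refine squeeze_zero' (Eventually.of_forall fun n => pow_nonneg (hR.nonneg _) n) ?_
      (tendsto_pow_atTop_nhds_zero_of_lt_one (hR.nonneg 0)
        ((dfR_lt_one_iff hF hk 0).2 (hlt 0)))
    filter_upwards [hqpos] with n hn
    exact pow_le_pow_left₀ (hR.nonneg _) (hR.mono (mul_nonpos_of_nonneg_of_nonpos hn.le hx)) n

theorem maxConverges_dfR_weibull {F : ℝ → ℝ} {α : ℝ} (hF : IsDF F) (hc : Continuous F) {k : ℕ}
    (hk : 1 ≤ k) (hα : 0 < α) (h : InMaxDomain F (weibull α)) :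
    rightEnd F < ⊤ ∧ MaxConverges (dfR F k)
      (fun n => (rightEnd F).toReal - quantile F (1 - (1 / (n : ℝ)) ^ (1 / (k : ℝ))))
      (fun _ => (rightEnd F).toReal) (weibull (k * α)) := by
  obtain ⟨a, b, hab⟩ := h
  have h := hab.tailConverges_weibull hF hα
  obtain ⟨htop, hr⟩ := h.weibull_rightEnd hF hα
  have hR := isDF_dfR hF hc hk
  have hb := hr.comp (tendsto_rootFloor hk)
  have hpos := (tendsto_rootFloor hk).eventually h.pos
  have hq : Tendsto (fun n : ℕ => ((rightEnd F).toReal -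
      quantile F (1 - (1 / (n : ℝ)) ^ (1 / (k : ℝ)))) / a (rootFloor k n)) atTop (𝓝 1) := by
    have h1 := hb.sub (h.tendsto_quantile hF hc hk (x := -1) (by simp) (by simp))
    rw [zero_sub, neg_neg] at h1
    refine h1.congr fun n => ?_
    simp only [Function.comp_apply]
    ring
  have hqpos : ∀ᶠ n : ℕ in atTop, 0 < (rightEnd F).toReal -
      quantile F (1 - (1 / (n : ℝ)) ^ (1 / (k : ℝ))) := by
    filter_upwards [hq.eventually (lt_mem_nhds one_pos), hpos] with n h1 h2
    have := mul_pos h1 h2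
    rwa [div_mul_cancel₀ _ h2.ne'] at this
  refine ⟨htop, hqpos, fun x _ => ?_⟩
  rcases lt_or_ge x 0 with hx | hx
  · have h1 := h.tendsto_dfR_pow hk (x := x)
      (t := fun n : ℕ => ((rightEnd F).toReal -
        quantile F (1 - (1 / (n : ℝ)) ^ (1 / (k : ℝ)))) * x + (rightEnd F).toReal) hx (by
        have h2 := (hq.mul_const x).add hb
        rw [one_mul, add_zero] at h2
        refine h2.congr fun n => ?_
        simp only [Function.comp_apply]
        ring)
    rw [weibull, if_pos hx]
    rwa [← Real.rpow_natCast (|x| ^ α), ← Real.rpow_mul (abs_nonneg x), mul_comm α] at h1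
  -- For `x ≥ 0` the argument is at or beyond `r(F)`, where `R_k = 1`.
  · rw [weibull, if_neg (not_lt.2 hx)]
    refine tendsto_const_nhds.congr' ?_
    filter_upwards [hqpos] with n hn
    have hone : ¬ dfR F k (((rightEnd F).toReal -
        quantile F (1 - (1 / (n : ℝ)) ^ (1 / (k : ℝ)))) * x + (rightEnd F).toReal) < 1 := by
      rw [dfR_lt_one_iff hF hk, ← hF.coe_lt_rightEnd, not_lt,
        ← EReal.coe_toReal htop.ne hF.bot_lt_rightEnd.ne', EReal.coe_le_coe_iff, EReal.toReal_coe]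
      have := mul_nonneg hn.le hx
      linarith
    rw [le_antisymm (hR.le_one _) (not_lt.1 hone), one_pow]

/-! ### The Gumbel domain -/

theorem MaxConverges.tailConverges_gumbel {F : ℝ → ℝ} {a b : ℕ → ℝ} (hF : IsDF F)
    (h : MaxConverges F a b gumbel) :
    TailConverges F a b Set.univ (fun x => Real.exp (-x)) := by
  refine h.tailConverges hF isOpen_univ ?_ ?_ fun x _ => rfl
  · intro x _ y _ hxy
    exact Real.exp_lt_exp.2 (neg_lt_neg hxy)
  · fun_prop

/-- The integer part of `1 / (1 - F t)`. -/
def tailIndex (F : ℝ → ℝ) (t : ℝ) : ℕ := ⌊(1 - F t)⁻¹⌋₊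

theorem IsDF.tendsto_inv_tail {F : ℝ → ℝ} (hF : IsDF F) (hc : Continuous F) :
    Tendsto (fun t => (1 - F t)⁻¹) (toRightEnd F) atTop := by
  refine tendsto_inv_nhdsGT_zero.comp (tendsto_nhdsWithin_iff.2 ⟨?_, ?_⟩)
  · have := (tendsto_nhds_of_tendsto_nhdsWithin (hF.tendsto_one hc)).const_sub 1
    rwa [sub_self] at this
  · filter_upwards [hF.eventually_lt_one] with t ht using sub_pos.2 ht

theorem IsDF.tendsto_tailIndex {F : ℝ → ℝ} (hF : IsDF F) (hc : Continuous F) :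
    Tendsto (tailIndex F) (toRightEnd F) atTop :=
  tendsto_nat_floor_atTop.comp (hF.tendsto_inv_tail hc)

theorem IsDF.tendsto_tailIndex_mul {F : ℝ → ℝ} (hF : IsDF F) (hc : Continuous F) :
    Tendsto (fun t => (tailIndex F t : ℝ) * (1 - F t)) (toRightEnd F) (𝓝 1) := by
  refine ((tendsto_nat_floor_div_atTop (R := ℝ)).comp (hF.tendsto_inv_tail hc)).congr fun t => ?_
  simp only [Function.comp_apply, div_inv_eq_mul]
  rfl

theorem IsDF.intervalIntegrable_tail {F : ℝ → ℝ} (hF : IsDF F) (s t : ℝ) :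
    IntervalIntegrable (fun x => 1 - F x) volume s t :=
  (antitone_const.add hF.mono.neg : Antitone fun x => 1 + -F x).intervalIntegrable

namespace TailConverges

variable {F : ℝ → ℝ} {a b : ℕ → ℝ}

/-- At index `N = tailIndex F t` the normalized tail at `t` tends to `1 = exp (-0)`, so `t` can
replace the centre `b N`. -/
theorem gumbel_centre (h : TailConverges F a b Set.univ (fun x => Real.exp (-x))) (hF : IsDF F)
    (hc : Continuous F) :
    Tendsto (fun t => (t - b (tailIndex F t)) / a (tailIndex F t)) (toRightEnd F) (𝓝 0) :=
  h.tendsto_normed (hF.tendsto_tailIndex hc) (t := fun t => t) (Set.mem_univ 0) (by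
    simpa using hF.tendsto_tailIndex_mul hc)

theorem gumbel_ratio (h : TailConverges F a b Set.univ (fun x => Real.exp (-x))) (hF : IsDF F)
    (hc : Continuous F) {s : ℝ → ℝ} {x : ℝ}
    (hs : Tendsto (fun t => (s t - t) / a (tailIndex F t)) (toRightEnd F) (𝓝 x)) :
    Tendsto (fun t => (1 - F (s t)) / (1 - F t)) (toRightEnd F) (𝓝 (Real.exp (-x))) := by
  have h1 := hs.add (h.gumbel_centre hF hc)
  rw [add_zero] at h1
  have h2 := (h.tendsto_tail (hF.tendsto_tailIndex hc) (t := s) (Set.mem_univ x)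
    (h1.congr fun t => by ring)).div (hF.tendsto_tailIndex_mul hc) one_ne_zero
  rw [div_one] at h2
  refine h2.congr' ?_
  filter_upwards [(hF.tendsto_tailIndex hc).eventually_gt_atTop 0, hF.eventually_lt_one]
    with t h3 h4
  have h3' : (tailIndex F t : ℝ) ≠ 0 := by positivity
  exact mul_div_mul_left _ _ h3'

/-- The positive finite limit of the tail ratio keeps `s t` below `r(F)` while its tail vanishes. -/
theorem gumbel_shift (h : TailConverges F a b Set.univ (fun x => Real.exp (-x))) (hF : IsDF F)
    (hc : Continuous F) {s : ℝ → ℝ} {x : ℝ}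
    (hs : Tendsto (fun t => (s t - t) / a (tailIndex F t)) (toRightEnd F) (𝓝 x)) :
    Tendsto s (toRightEnd F) (toRightEnd F) := by
  have hr := h.gumbel_ratio hF hc hs
  refine hF.tendsto_toRightEnd (tendsto_nhdsWithin_iff.2 ⟨?_, ?_⟩)
  · have h1 := (tendsto_nhds_of_tendsto_nhdsWithin (hF.tendsto_one hc)).const_sub 1
    have h2 := (hr.mul h1).const_sub 1
    rw [sub_self, mul_zero, sub_zero] at h2
    refine h2.congr' ?_
    filter_upwards [hF.eventually_lt_one] with t ht
    rw [div_mul_cancel₀ _ (sub_pos.2 ht).ne', sub_sub_cancel]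
  · filter_upwards [hr.eventually (lt_mem_nhds (Real.exp_pos _)), hF.eventually_lt_one] with t h1 h2
    have := mul_pos h1 (sub_pos.2 h2)
    rw [div_mul_cancel₀ _ (sub_pos.2 h2).ne'] at this
    exact sub_pos.1 this

theorem eventually_scale_pos (h : TailConverges F a b Set.univ (fun x => Real.exp (-x)))
    (hF : IsDF F) (hc : Continuous F) : ∀ᶠ t in toRightEnd F, 0 < a (tailIndex F t) :=
  (hF.tendsto_tailIndex hc).eventually h.pos

theorem gumbel_add_scale (h : TailConverges F a b Set.univ (fun x => Real.exp (-x))) (hF : IsDF F)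
    (hc : Continuous F) (x : ℝ) :
    Tendsto (fun t => (a (tailIndex F t) * x + t - t) / a (tailIndex F t)) (toRightEnd F)
      (𝓝 x) := by
  refine tendsto_const_nhds.congr' ?_
  filter_upwards [h.eventually_scale_pos hF hc] with t ht
  field_simp
  ring

/-- A move by one scale unit multiplies the index by `e` asymptotically; in the Gumbel case that
only translates `τ`, so the scale is unchanged in the limit. -/
theorem gumbel_scale_ratio (h : TailConverges F a b Set.univ (fun x => Real.exp (-x)))
    (hF : IsDF F) (hc : Continuous F) :
    Tendsto (fun t => a (tailIndex F (a (tailIndex F t) * 1 + t)) / a (tailIndex F t))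
      (toRightEnd F) (𝓝 1) := by
  have hs := h.gumbel_add_scale hF hc 1
  have hshift := h.gumbel_shift hF hc hs
  have hM := (hF.tendsto_tailIndex hc).comp hshift
  refine (h.tendsto_types (M := fun t => tailIndex F (a (tailIndex F t) * 1 + t)) hM
    (hF.tendsto_tailIndex hc) (c := Real.exp 1) (κ := 1) (θ := 1) (Real.exp_pos 1).ne' ?_
    Set.univ_nonempty (fun _ _ => Set.mem_univ _) fun x _ => ?_).1
  · have h1 := (((hF.tendsto_tailIndex_mul hc).comp hshift).div (hF.tendsto_tailIndex_mul hc)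
      one_ne_zero).div (h.gumbel_ratio hF hc hs) (Real.exp_pos _).ne'
    have h2 : (1 : ℝ) / 1 / Real.exp (-1) = Real.exp 1 := by
      rw [div_one, one_div, ← Real.exp_neg, neg_neg]
    rw [h2] at h1
    refine h1.congr' ?_
    filter_upwards [(hF.tendsto_tailIndex hc).eventually_gt_atTop 0, hF.eventually_lt_one,
      hshift.eventually hF.eventually_lt_one] with t h3 h4 h5
    have h3' : (tailIndex F t : ℝ) ≠ 0 := by positivity
    have h4' := (sub_pos.2 h4).ne'
    have h5' := (sub_pos.2 h5).ne'
    simp only [Pi.div_apply, Function.comp_apply]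
    rw [div_div, mul_assoc, mul_div_cancel₀ _ h4', mul_div_mul_right _ _ h5']
  · rw [← Real.exp_sub]; congr 1; ring

/-- After the substitution `s = a y + t`, dominated convergence applies with the bound 1. -/
theorem gumbel_integral (h : TailConverges F a b Set.univ (fun x => Real.exp (-x)))
    (hF : IsDF F) (hc : Continuous F) {L : ℝ} (hL : 0 ≤ L) :
    Tendsto (fun t => (∫ s in t..(a (tailIndex F t) * L + t), (1 - F s)) /
      (a (tailIndex F t) * (1 - F t))) (toRightEnd F) (𝓝 (1 - Real.exp (-L))) := by
  have hexp : ∫ y in (0 : ℝ)..L, Real.exp (-y) = 1 - Real.exp (-L) := by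
    rw [intervalIntegral.integral_comp_neg (fun y => Real.exp y), integral_exp, neg_zero,
      Real.exp_zero]
  have h1 : Tendsto (fun t => ∫ y in (0 : ℝ)..L, (1 - F (a (tailIndex F t) * y + t)) / (1 - F t))
      (toRightEnd F) (𝓝 (∫ y in (0 : ℝ)..L, Real.exp (-y))) := by
    refine intervalIntegral.tendsto_integral_filter_of_dominated_convergence (fun _ => 1) ?_ ?_ ?_ ?_
    · exact Eventually.of_forall fun t => (by fun_prop : Continuous fun y =>
        (1 - F (a (tailIndex F t) * y + t)) / (1 - F t)).aestronglyMeasurable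
    · filter_upwards [hF.eventually_lt_one, h.eventually_scale_pos hF hc] with t ht hpos
      refine Eventually.of_forall fun y hy => ?_
      rw [Set.uIoc_of_le hL] at hy
      have h2 : F t ≤ F (a (tailIndex F t) * y + t) :=
        hF.mono (by have := mul_pos hpos hy.1; linarith)
      have h3 := sub_nonneg.2 (hF.le_one (a (tailIndex F t) * y + t))
      rw [Real.norm_of_nonneg (div_nonneg h3 (sub_pos.2 ht).le), div_le_one (sub_pos.2 ht)]
      linarith
    · exact intervalIntegrable_const
    · exact Eventually.of_forall fun y _ =>
        h.gumbel_ratio hF hc (s := fun t => a (tailIndex F t) * y + t)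
          (h.gumbel_add_scale hF hc y)
  rw [hexp] at h1
  refine h1.congr' ?_
  filter_upwards [h.eventually_scale_pos hF hc] with t hpos
  rw [intervalIntegral.integral_div,
    intervalIntegral.integral_comp_mul_add (fun s => 1 - F s) hpos.ne', mul_zero, zero_add,
    smul_eq_mul]
  field_simp

/-- The bound is uniform in `M`. Cut the range into steps of one scale unit: each step multiplies
scale times tail by at most `q`, where `q` is just above `e⁻¹`, and one block is at most `K (1 - q)`
times that product, so the blocks sum geometrically. -/
theorem gumbel_integral_le (h : TailConverges F a b Set.univ (fun x => Real.exp (-x)))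
    (hF : IsDF F) (hc : Continuous F) {K : ℝ} (hK : 1 < K) :
    ∀ᶠ t in toRightEnd F, ∀ M, t ≤ M →
      ∫ s in t..M, (1 - F s) ≤ K * (a (tailIndex F t) * (1 - F t)) := by
  have hK0 : 0 < K := one_pos.trans hK
  have he1 : Real.exp (-1) < 1 := by
    rw [← Real.exp_zero, Real.exp_lt_exp]; norm_num
  obtain ⟨q, hq, hqK⟩ : ∃ q, Real.exp (-1) < q ∧ q < 1 - (1 - Real.exp (-1)) / K := by
    refine exists_between ?_
    have : (1 - Real.exp (-1)) / K < 1 - Real.exp (-1) := div_lt_self (by linarith) hK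
    linarith
  have hq0 : 0 < q := (Real.exp_pos _).trans hq
  have hC : 1 - Real.exp (-1) < K * (1 - q) := by
    have := (div_lt_iff₀ hK0).1 (show (1 - Real.exp (-1)) / K < 1 - q by linarith)
    linarith
  have hq1 : q < 1 := by
    have : 0 < (1 - Real.exp (-1)) / K := div_pos (by linarith) hK0
    linarith
  have hs := h.gumbel_add_scale hF hc 1
  have hratio := h.gumbel_ratio hF hc (s := fun t => a (tailIndex F t) * 1 + t) hs
  have hscale := (h.gumbel_scale_ratio hF hc).mul hratio
  rw [one_mul] at hscale
  obtain ⟨t₀, ht₀, H⟩ := hF.hasBasis_toRightEnd.eventually_iff.1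
    ((h.eventually_scale_pos hF hc).and (((h.gumbel_shift hF hc hs).eventually
      hF.eventually_lt_one).and ((hratio.eventually (gt_mem_nhds hq)).and
        ((hscale.eventually (gt_mem_nhds hq)).and
          ((h.gumbel_integral hF hc zero_le_one).eventually (gt_mem_nhds hC))))))
  refine hF.hasBasis_toRightEnd.eventually_iff.2 ⟨t₀, ht₀, ?_⟩
  have hint := hF.intervalIntegrable_tail
  have hT : ∀ s, 0 ≤ 1 - F s := fun s => sub_nonneg.2 (hF.le_one s)
  -- The steps need not reach `M`; the crude last term bounds what is left after `j` of them, and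
  -- vanishes as `j → ∞` with `M` fixed.
  have key : ∀ j : ℕ, ∀ t, t₀ < t → F t < 1 → ∀ M, t ≤ M → ∫ s in t..M, (1 - F s) ≤
      K * (a (tailIndex F t) * (1 - F t)) + q ^ j * (1 - F t) * (M - t) := by
    intro j
    induction j with
    | zero =>
      intro t htt ht M hM
      obtain ⟨hpos, -⟩ := H ⟨htt, ht⟩
      have h1 : ∫ s in t..M, (1 - F s) ≤ ∫ _ in t..M, (1 - F t) :=
        intervalIntegral.integral_mono_on hM (hint _ _) intervalIntegrable_const fun s hs => by
          linarith [hF.mono hs.1]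
      rw [intervalIntegral.integral_const, smul_eq_mul] at h1
      have h2 := mul_nonneg hK0.le (mul_nonneg hpos.le (hT t))
      rw [pow_zero, one_mul]
      linarith
    | succ j ih =>
      intro t htt ht M hM
      obtain ⟨hpos, hlt, h1, h2, h3⟩ := H ⟨htt, ht⟩
      have hTt := sub_pos.2 ht
      set s := a (tailIndex F t) * 1 + t with hsdef
      have hts : t < s := by linarith
      rw [div_lt_iff₀ hTt] at h1
      rw [div_mul_div_comm, div_lt_iff₀ (mul_pos hpos hTt)] at h2
      rw [div_lt_iff₀ (mul_pos hpos hTt)] at h3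
      have hqj := pow_pos hq0 (j + 1)
      rcases le_or_gt s M with hsM | hsM
      · have h4 := ih s (htt.trans hts) hlt M hsM
        rw [← intervalIntegral.integral_add_adjacent_intervals (hint t s) (hint s M)]
        have h5 := mul_le_mul_of_nonneg_left h2.le hK0.le
        have h6 : q ^ j * (1 - F s) * (M - s) ≤ q ^ (j + 1) * (1 - F t) * (M - t) := by
          have h7 : q ^ j * (1 - F s) ≤ q ^ (j + 1) * (1 - F t) := by
            rw [pow_succ, mul_assoc]
            exact mul_le_mul_of_nonneg_left h1.le (pow_pos hq0 j).le
          exact mul_le_mul h7 (by linarith) (by linarith) (mul_pos hqj hTt).le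
        linarith
      · have h4 : ∫ u in t..M, (1 - F u) ≤ ∫ u in t..s, (1 - F u) := by
          rw [← intervalIntegral.integral_add_adjacent_intervals (hint t M) (hint M s)]
          have := intervalIntegral.integral_nonneg (μ := volume) hsM.le fun u (_ : u ∈ Set.Icc M s) => hT u
          linarith
        have h5 := mul_nonneg (mul_pos hqj hTt).le (sub_nonneg.2 hM)
        have h6 := mul_pos (mul_pos hK0 hq0) (mul_pos hpos hTt)
        linarith
  intro t ht M hM
  have hlim : Tendsto (fun j : ℕ => K * (a (tailIndex F t) * (1 - F t)) +
      q ^ j * (1 - F t) * (M - t)) atTop (𝓝 (K * (a (tailIndex F t) * (1 - F t)) +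
        0 * (1 - F t) * (M - t))) :=
    (((tendsto_pow_atTop_nhds_zero_of_lt_one hq0.le hq1).mul_const _).mul_const _).const_add _
  rw [zero_mul, zero_mul, add_zero] at hlim
  exact ge_of_tendsto' hlim fun j => key j t ht.1 ht.2 M hM

theorem gumbel_integrableOn (h : TailConverges F a b Set.univ (fun x => Real.exp (-x)))
    (hF : IsDF F) (hc : Continuous F) (t : ℝ) :
    IntegrableOn (fun s => 1 - F s) (Set.Ioi t) := by
  have hT : ∀ s, 0 ≤ 1 - F s := fun s => sub_nonneg.2 (hF.le_one s)
  have hIoc : ∀ u v : ℝ, IntegrableOn (fun s => 1 - F s) (Set.Ioc u v) := fun u v =>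
    (hF.intervalIntegrable_tail u v).1
  obtain ⟨u, hu⟩ : ∃ u, IntegrableOn (fun s => 1 - F s) (Set.Ioi u) := by
    -- A trivial filter would force `F = 1` beyond some `t₀`, where the tail is zero.
    rcases (toRightEnd F).eq_or_neBot with hbot | hne
    · obtain ⟨t₀, ht₀, H⟩ := hF.hasBasis_toRightEnd.eventually_iff.1
        (show ∀ᶠ _ in toRightEnd F, False by rw [hbot]; exact eventually_bot)
      refine ⟨t₀, integrableOn_zero.congr_fun (fun s hs => ?_) measurableSet_Ioi⟩
      have h1 : ¬ F s < 1 := fun h2 => H ⟨hs, h2⟩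
      have h2 := le_antisymm (hF.le_one s) (not_lt.1 h1)
      simp only [h2, sub_self]
    · obtain ⟨u, hu⟩ := (h.gumbel_integral_le hF hc one_lt_two).exists
      refine ⟨u, integrableOn_Ioi_of_intervalIntegral_norm_bounded
        (2 * (a (tailIndex F u) * (1 - F u))) u (fun M : ℝ => hIoc u M)
        tendsto_id ?_⟩
      · filter_upwards [eventually_ge_atTop u] with M hM
        refine le_trans (le_of_eq ?_) (hu M hM)
        exact intervalIntegral.integral_congr fun s _ => Real.norm_of_nonneg (hT s)
  refine ((hIoc t u).union hu).mono_set fun s hs => ?_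
  rcases le_or_gt s u with h1 | h1
  · exact Or.inl ⟨hs, h1⟩
  · exact Or.inr h1

/-- From below, truncate the integral at `L` scale units and let `L` grow; from above, let `M → ∞`
in the uniform bound. -/
theorem gumbel_meanResidualLife (h : TailConverges F a b Set.univ (fun x => Real.exp (-x)))
    (hF : IsDF F) (hc : Continuous F) :
    Tendsto (fun t => meanResidualLife F t / a (tailIndex F t)) (toRightEnd F) (𝓝 1) := by
  have hT : ∀ s, 0 ≤ 1 - F s := fun s => sub_nonneg.2 (hF.le_one s)
  have hint := h.gumbel_integrableOn hF hc
  refine tendsto_order.2 ⟨fun y hy => ?_, fun y hy => ?_⟩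
  · have hlim : Tendsto (fun L : ℝ => 1 - Real.exp (-L)) atTop (𝓝 (1 - 0)) :=
      (Real.tendsto_exp_atBot.comp tendsto_neg_atTop_atBot).const_sub 1
    rw [sub_zero] at hlim
    obtain ⟨L, hL, hL0⟩ := ((hlim.eventually (lt_mem_nhds hy)).and (eventually_ge_atTop 0)).exists
    filter_upwards [(h.gumbel_integral hF hc hL0).eventually (lt_mem_nhds hL),
      h.eventually_scale_pos hF hc, hF.eventually_lt_one] with t h1 h2 h3
    refine h1.trans_le ?_
    rw [meanResidualLife, div_div, mul_comm (1 - F t)]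
    have hTt := sub_pos.2 h3
    have hle : t ≤ a (tailIndex F t) * L + t := by have := mul_nonneg h2.le hL0; linarith
    rw [intervalIntegral.integral_of_le hle]
    refine div_le_div_of_nonneg_right ?_ (mul_pos h2 hTt).le
    exact setIntegral_mono_set (hint t) (Eventually.of_forall hT)
      (Set.Ioc_subset_Ioi_self).eventuallyLE
  · obtain ⟨K, hK1, hKy⟩ := exists_between hy
    filter_upwards [h.gumbel_integral_le hF hc hK1, h.eventually_scale_pos hF hc,
      hF.eventually_lt_one] with t h1 h2 h3
    have hTt := sub_pos.2 h3
    refine lt_of_le_of_lt ?_ hKy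
    rw [meanResidualLife, div_div, mul_comm (1 - F t), div_le_iff₀ (mul_pos h2 hTt)]
    refine le_of_tendsto (intervalIntegral_tendsto_integral_Ioi t (hint t) tendsto_id) ?_
    filter_upwards [eventually_ge_atTop t] with M hM using h1 M hM

theorem gumbel_isAuxiliary (h : TailConverges F a b Set.univ (fun x => Real.exp (-x)))
    (hF : IsDF F) (hc : Continuous F) : IsAuxiliary F (meanResidualLife F) := by
  have hT : ∀ s, 0 ≤ 1 - F s := fun s => sub_nonneg.2 (hF.le_one s)
  refine ⟨fun t ht => ?_, fun x _ => ?_⟩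
  · obtain ⟨u, htu, hu⟩ := EReal.lt_iff_exists_real_btwn.1 ht
    have htu' : t < u := EReal.coe_lt_coe_iff.1 htu
    have hTu := sub_pos.2 (hF.coe_lt_rightEnd.1 hu)
    refine div_pos ?_ (sub_pos.2 (hF.coe_lt_rightEnd.1 ht))
    calc (0 : ℝ) < (u - t) * (1 - F u) := mul_pos (sub_pos.2 htu') hTu
      _ = ∫ _ in t..u, (1 - F u) := by rw [intervalIntegral.integral_const, smul_eq_mul]
      _ ≤ ∫ s in t..u, (1 - F s) :=
        intervalIntegral.integral_mono_on htu'.le intervalIntegrable_const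
          (hF.intervalIntegrable_tail _ _) fun s hs => by linarith [hF.mono hs.2]
      _ = ∫ s in Set.Ioc t u, (1 - F s) := intervalIntegral.integral_of_le htu'.le
      _ ≤ _ := setIntegral_mono_set (h.gumbel_integrableOn hF hc t) (Eventually.of_forall hT)
        (Set.Ioc_subset_Ioi_self).eventuallyLE
  · refine h.gumbel_ratio hF hc (s := fun t => t + meanResidualLife F t * x) ?_
    have h1 := (h.gumbel_meanResidualLife hF hc).mul_const x
    rw [one_mul] at h1
    refine h1.congr fun t => ?_
    ring

/-- The quantiles `β n` serve as centres for `F` at index `rootFloor k n`, and `v (β n)` is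
asymptotic to the scale there. The divisor `k` compensates the `k`-th power: `exp (-x / k)^k = exp
(-x)`. -/
theorem maxConverges_dfR_gumbel (h : TailConverges F a b Set.univ (fun x => Real.exp (-x)))
    (hF : IsDF F) (hc : Continuous F) {k : ℕ} (hk : 1 ≤ k) {v : ℝ → ℝ} (hv : IsAuxiliary F v) :
    MaxConverges (dfR F k) (fun n => v (quantile (dfR F k) (1 - 1 / (n : ℝ))) / k)
      (fun n => quantile (dfR F k) (1 - 1 / (n : ℝ))) gumbel := by
  have hR := isDF_dfR hF hc hk
  have hRc := continuous_dfR hF hc k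
  set β : ℕ → ℝ := fun n => quantile (dfR F k) (1 - 1 / (n : ℝ)) with hβ
  have hRβ : ∀ᶠ n : ℕ in atTop, dfR F k (β n) = 1 - 1 / (n : ℝ) := by
    filter_upwards [eventually_gt_atTop 1] with n hn
    have hn1 : (1 : ℝ) < n := by exact_mod_cast hn
    have h1 : 1 / (n : ℝ) < 1 := (div_lt_one (by linarith)).2 hn1
    have h2 : 0 < 1 / (n : ℝ) := one_div_pos.2 (by linarith)
    exact hR.apply_quantile hRc (by linarith) (by linarith)
  have hβr : Tendsto β atTop (toRightEnd F) := by
    have h1 : rightEnd (dfR F k) = rightEnd F := IsDF.rightEnd_eq_of_iff (dfR_lt_one_iff hF hk)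
    have h2 : toRightEnd (dfR F k) = toRightEnd F := by rw [toRightEnd, h1, toRightEnd]
    rw [← h2]
    refine hR.tendsto_toRightEnd (tendsto_nhdsWithin_iff.2 ⟨?_, ?_⟩)
    · have h3 := (tendsto_one_div_atTop_nhds_zero_nat (𝕜 := ℝ)).const_sub 1
      rw [sub_zero] at h3
      exact h3.congr' (hRβ.mono fun n hn => hn.symm)
    · filter_upwards [hRβ, eventually_gt_atTop 0] with n hn h0
      have : 0 < 1 / (n : ℝ) := by positivity
      rw [Set.mem_Iio, hn]
      linarith
  have hFβ : Tendsto (fun n => F (β n)) atTop (𝓝 1) :=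
    tendsto_nhds_of_tendsto_nhdsWithin ((hF.tendsto_one hc).comp hβr)
  have hlt := hβr.eventually hF.eventually_lt_one
  have hpos := (tendsto_rootFloor hk).eventually h.pos
  have htail : Tendsto (fun n => (rootFloor k n : ℝ) * (1 - F (β n))) atTop (𝓝 1) := by
    rw [tendsto_rootFloor_mul_iff hk]
    have h1 := (tendsto_logOddsRatio.comp hFβ).inv₀ one_ne_zero
    rw [inv_one] at h1
    refine h1.congr' ?_
    filter_upwards [hRβ, hFβ.eventually (lt_mem_nhds one_pos), eventually_gt_atTop 0]
      with n h2 h3 h4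
    have hn : (n : ℝ) ≠ 0 := by positivity
    have h5 : (n : ℝ) * (1 - dfR F k (β n)) = 1 := by
      rw [h2, sub_sub_cancel, mul_one_div_cancel hn]
    -- The equation `R_k (β n) = 1 - 1 / n` is exact, so its `k`-th root can be taken before passing
    -- to the limit.
    have h6 : ((n : ℝ) ^ (1 / (k : ℝ)) * logOdds (F (β n))) ^ k = 1 := by
      rw [mul_pow, ← Real.rpow_natCast, ← Real.rpow_mul n.cast_nonneg,
        one_div_mul_cancel (by positivity), Real.rpow_one, ← h5, one_sub_dfR h3, logOdds_eq_mul,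
        mul_pow]
    have h7 := (pow_eq_one_iff_of_nonneg (mul_nonneg (Real.rpow_nonneg n.cast_nonneg _)
      (logOdds_nonneg h3.le (hF.le_one _))) (Nat.one_le_iff_ne_zero.1 hk)).1 h6
    rw [logOdds_eq_mul, ← mul_assoc] at h7
    exact (eq_inv_of_mul_eq_one_left h7).symm
  have hcentre := h.tendsto_normed (tendsto_rootFloor hk) (t := β) (Set.mem_univ 0) (by
    simpa using htail)
  have hvβ : Tendsto (fun n => v (β n) / a (rootFloor k n)) atTop (𝓝 1) := by
    -- The auxiliary property at `x = 1` alone fixes the size of `v`: the tail at `β n + v (β n)`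
    -- places that point one scale unit from the centre.
    have h1 := ((hv.2 1 zero_le_one).comp hβr).mul htail
    rw [mul_one] at h1
    have h2 := (h.tendsto_normed (tendsto_rootFloor hk) (t := fun n => β n + v (β n) * 1)
      (Set.mem_univ 1) (h1.congr' (by
        filter_upwards [hlt] with n hn
        have := (sub_pos.2 hn).ne'
        simp only [Function.comp_apply]
        field_simp))).sub hcentre
    rw [sub_zero] at h2
    refine h2.congr fun n => ?_
    ring
  have hk0 : (0 : ℝ) < k := by positivity
  refine ⟨?_, fun x _ => ?_⟩
  · filter_upwards [hlt] with n hn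
    exact div_pos (hv.1 _ (hF.coe_lt_rightEnd.2 hn)) hk0
  · have h1 := h.tendsto_dfR_pow hk (x := x / k) (t := fun n => v (β n) / k * x + β n)
      (Set.mem_univ _) (by
        have h2 := (hvβ.mul_const (x / k)).add hcentre
        rw [one_mul, add_zero] at h2
        refine h2.congr fun n => ?_
        ring)
    rw [← Real.exp_nat_mul, mul_neg, mul_div_cancel₀ _ hk0.ne'] at h1
    exact h1

end TailConverges

end

theorem mainTheorem4 (F f : ℝ → ℝ) (hF : IsDF F) (hf : IsPDF F f) (k : ℕ) (hk : 1 ≤ k) :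
    -- (a)
    (IsDF (dfR F k) ∧ IsPDF (dfR F k) (pdfR F f k) ∧ rightEnd (dfR F k) = rightEnd F ∧
      Tendsto (fun x => (1 - dfR F k x) / (1 - F x) ^ k) (toRightEnd F) (𝓝 1) ∧
      TailEquivalent (dfR F k) (dfH F k)) ∧
    -- (b)
    (∀ α : ℝ, 0 < α → InMaxDomain F (frechet α) →
      rightEnd (dfR F k) = rightEnd F ∧ rightEnd F = ⊤ ∧
      InMaxDomain (dfR F k) (frechet (k * α)) ∧
      MaxConverges (dfR F k)
        (fun n => quantile F (1 - (1 / (n : ℝ)) ^ (1 / (k : ℝ)))) (fun _ => 0)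
        (frechet (k * α))) ∧
    -- (c)
    (∀ α : ℝ, 0 < α → InMaxDomain F (weibull α) →
      rightEnd (dfR F k) = rightEnd F ∧ rightEnd F < ⊤ ∧
      InMaxDomain (dfR F k) (weibull (k * α)) ∧
      MaxConverges (dfR F k)
        (fun n => (rightEnd F).toReal - quantile F (1 - (1 / (n : ℝ)) ^ (1 / (k : ℝ))))
        (fun _ => (rightEnd F).toReal)
        (weibull (k * α))) ∧
    -- (d)
    (InMaxDomain F gumbel →
      rightEnd (dfR F k) = rightEnd F ∧
      InMaxDomain (dfR F k) gumbel ∧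
      IsAuxiliary F (meanResidualLife F) ∧
      ∀ v : ℝ → ℝ, IsAuxiliary F v →
        MaxConverges (dfR F k)
          (fun n => v (quantile (dfR F k) (1 - 1 / (n : ℝ))) / k)
          (fun n => quantile (dfR F k) (1 - 1 / (n : ℝ)))
          gumbel) := by
  have hc := hf.continuous
  have hr : rightEnd (dfR F k) = rightEnd F := IsDF.rightEnd_eq_of_iff (dfR_lt_one_iff hF hk)
  refine ⟨⟨isDF_dfR hF hc hk, isPDF_dfR hF hf hk, hr, tendsto_tail_dfR hF hc k,
    tailEquivalent_dfR_dfH hF hc hk⟩, fun α hα h => ?_, fun α hα h => ?_, fun h => ?_⟩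
  · obtain ⟨h1, h2⟩ := maxConverges_dfR_frechet hF hc hk hα h
    exact ⟨hr, h1, ⟨_, _, h2⟩, h2⟩
  · obtain ⟨h1, h2⟩ := maxConverges_dfR_weibull hF hc hk hα h
    exact ⟨hr, h1, ⟨_, _, h2⟩, h2⟩
  · obtain ⟨a, b, hab⟩ := h
    have h := hab.tailConverges_gumbel hF
    have haux := h.gumbel_isAuxiliary hF hc
    exact ⟨hr, ⟨_, _, h.maxConverges_dfR_gumbel hF hc hk haux⟩, haux,
      fun v hv => h.maxConverges_dfR_gumbel hF hc hk hv⟩
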